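/- Let $\mathscr H,\mathscr K$ be arbitrary (possibly nonseparable) complex Hilbert spaces, let $X,Y$ be measurable spaces, and let $E:\Sigma_X\to\mathfrak B(\mathscr H)$, $F:\Sigma_Y\to\mathfrak B(\mathscr K)$ be projection-valued measures. Let $\mathfrak S_2=\mathfrak S_2(\mathscr K,\mathscr H)$ be the Hilbert space of Hilbert–Schmidt operators $\mathscr K\to\mathscr H$. There is a unique projection-valued measure $\mathcal G:\Sigma_{X\times Y}\to\mathfrak B(\mathfrak S_2)$ on the product $\sigma$-algebra with $\mathcal G(\Gamma\times\Delta)T=E(\Gamma)TF(\Delta)$ for all $\Gamma\in\Sigma_X$, $\Delta\in\Sigma_Y$, $T\in\mathfrak S_2$. Write $B(X\times Y)$ for the $*$-algebra of bounded measurable functions $X\times Y\to\mathbb C$, and let $\pi:B(X\times Y)\to L^\infty(\mathcal G)$ be the quotient by the functions vanishing $\mathcal G$-a.e., where $\|\pi(\phi)\|_{L^\infty(\mathcal G)}$ is the $\mathcal G$-essential supremum of $|\phi|$. Put $E_{v,v}(\cdot)=\langle v,E(\cdot)v\rangle$ and $F_{w,w}(\cdot)=\langle w,F(\cdot)w\rangle$.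 Consider finite positive measure spaces $(Z,\Sigma_Z,\nu)$ with bounded measurable functions $\alpha:X\times Z\to\mathbb C$, $\beta:Y\times Z\to\mathbb C$; put $\alpha_z=\alpha(\cdot,z)$, $\beta_z=\beta(\cdot,z)$. Such data are a strict decomposition (respectively, a decomposition) of $\phi:X\times Y\to\mathbb C$ if $$\phi(x,y)=\int_Z\alpha(x,z)\beta(y,z)\,d\nu(z)$$ for all $(x,y)$ (respectively, for $\mathcal G$-a.e. $(x,y)$). Let $\mathfrak M_{00}$ be the set of functions on $X\times Y$ with a strict decomposition, $\mathfrak M=\pi(\mathfrak M_{00})$, $\mathfrak M_0=\pi^{-1}(\mathfrak M)\subseteq B(X\times Y)$, and for $\phi\in\mathfrak M_0$ let $$\|\phi\|_{\mathfrak M_0}=\inf\ \sup_{v\in\mathscr H,\,w\in\mathscr K}\int_Z\|\alpha_z\|_{L^\infty(E_{v,v})}\,\|\beta_z\|_{L^\infty(F_{w,w})}\,d\nu(z),$$ the infimum being over all decompositions $(Z,\Sigma_Z,\nu,\alpha,\beta)$ of $\phi$. Then: 1. $\mathfrak M_{00}$ is a $*$-subalgebra of $B(X\times Y)$ containing the constant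 function $1$; $\mathfrak M_0$ is a unital $*$-subalgebra of $B(X\times Y)$, and $\mathfrak M$ is a unital $*$-subalgebra of $L^\infty(\mathcal G)$. 2. $\|\cdot\|_{\mathfrak M_0}$ is a (finite) submultiplicative seminorm on $\mathfrak M_0$, invariant under complex conjugation, and $\|\pi(\phi)\|_{L^\infty(\mathcal G)}\le\|\phi\|_{\mathfrak M_0}$ for every $\phi\in\mathfrak M_0$. 3. $\|\phi\|_{\mathfrak M_0}=0$ if and only if $\pi(\phi)=0$, and $\|\cdot\|_{\mathfrak M_0}$ descends to a well-defined norm $\|\cdot\|_{\mathfrak M}$ on $\mathfrak M$, under which $\mathfrak M$ is a unital Banach $*$-algebra: the norm is complete and submultiplicative, the involution is isometric, and $\|1\|_{\mathfrak M}=1$ whenever $\mathscr H\ne0$ and $\mathscr K\ne0$. -/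

import Mathlib

universe uX uY uH uK uZ

open MeasureTheory
open scoped ENNReal InnerProductSpace

noncomputable section

/-! ### Projection-valued measures -/

/-- A projection-valued measure on the measurable space `X` with values in the orthogonal
projections of the complex Hilbert space `H`; countable additivity is in the weak operator
topology.  Values at non-measurable sets carry no meaning and are normalised to `0`, so that two
projection-valued measures are equal as soon as they agree on measurable sets. -/
structure PVM (X : Type*) [MeasurableSpace X] (H : Type*) [NormedAddCommGroup H]
    [InnerProductSpace ℂ H] [CompleteSpace H] where
  toFun : Set X → H →L[ℂ] H
  isStarProjection' : ∀ s, MeasurableSet s → IsStarProjection (toFun s)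
  univ' : toFun Set.univ = 1
  iUnion' : ∀ s : ℕ → Set X, (∀ n, MeasurableSet (s n)) → Pairwise (fun m n => Disjoint (s m) (s n)) →
    ∀ v w : H, HasSum (fun n => ⟪v, toFun (s n) w⟫_ℂ) ⟪v, toFun (⋃ n, s n) w⟫_ℂ
  not_measurable' : ∀ s, ¬ MeasurableSet s → toFun s = 0

namespace PVM

variable {X : Type*} [MeasurableSpace X] {H : Type*} [NormedAddCommGroup H]
  [InnerProductSpace ℂ H] [CompleteSpace H]

instance : CoeFun (PVM X H) (fun _ => Set X → H →L[ℂ] H) := ⟨PVM.toFun⟩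

theorem isStarProjection (E : PVM X H) (s : Set X) : IsStarProjection (E s) := by
  by_cases hs : MeasurableSet s
  · exact E.isStarProjection' s hs
  · rw [E.not_measurable' s hs]; exact .zero _

theorem inner_self_eq (E : PVM X H) (s : Set X) (v : H) :
    ⟪v, E s v⟫_ℂ = ((‖E s v‖ ^ 2 : ℝ) : ℂ) := by
  have h1 : E s (E s v) = E s v := congrArg (fun T : H →L[ℂ] H => T v)
    (E.isStarProjection s).isIdempotentElem
  have h2 : ContinuousLinearMap.adjoint (E s) = E s := (E.isStarProjection s).isSelfAdjoint
  calc ⟪v, E s v⟫_ℂ = ⟪v, E s (E s v)⟫_ℂ := by rw [h1]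
    _ = ⟪ContinuousLinearMap.adjoint (E s) v, E s v⟫_ℂ :=
        (ContinuousLinearMap.adjoint_inner_left _ _ _).symm
    _ = ((‖E s v‖ ^ 2 : ℝ) : ℂ) := by rw [h2, inner_self_eq_norm_sq_to_K]; norm_cast

theorem map_empty (E : PVM X H) : E ∅ = 0 := by
  ext w
  refine ext_inner_left ℂ fun v => ?_
  have h := E.iUnion' (fun _ => ∅) (fun _ => MeasurableSet.empty)
    (fun _ _ _ => disjoint_bot_left) v w
  have h0 := (summable_const_iff _).1 h.summable
  rw [h0]; simp

/-- The finite positive measure `E_{v,v}`, given by `E_{v,v}(s) = ⟨v, E(s) v⟩`. -/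
def diagMeasure (E : PVM X H) (v : H) : Measure X :=
  Measure.ofMeasurable (fun s _ => ENNReal.ofReal (⟪v, E s v⟫_ℂ).re)
    (by simp [E.map_empty])
    (by
      intro s hs hd
      have h := (Complex.hasSum_re (E.iUnion' s hs hd v v))
      have hnn : ∀ n, 0 ≤ (⟪v, E (s n) v⟫_ℂ).re := fun n => by
        rw [E.inner_self_eq, Complex.ofReal_re]; positivity
      rw [← h.tsum_eq, ENNReal.ofReal_tsum_of_nonneg hnn h.summable])

theorem diagMeasure_apply (E : PVM X H) (v : H) {s : Set X} (hs : MeasurableSet s) :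
    E.diagMeasure v s = ENNReal.ofReal (⟪v, E s v⟫_ℂ).re :=
  Measure.ofMeasurable_apply s hs

theorem eq_zero_iff (E : PVM X H) {s : Set X} (hs : MeasurableSet s) :
    E s = 0 ↔ ∀ v, E.diagMeasure v s = 0 := by
  constructor
  · intro h v
    rw [E.diagMeasure_apply v hs, h]; simp
  · intro h
    ext v
    have := h v
    rw [E.diagMeasure_apply v hs, E.inner_self_eq, Complex.ofReal_re, ENNReal.ofReal_eq_zero] at this
    have h0 : ‖E s v‖ = 0 := by
      have := le_antisymm this (by positivity)
      exact pow_eq_zero_iff (two_ne_zero) |>.1 this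
    simpa using h0

/-- The property `p` holds `E`-almost everywhere: it holds off a measurable set `N` with
`E(N) = 0`. -/
def AE (E : PVM X H) (p : X → Prop) : Prop :=
  ∃ N : Set X, MeasurableSet N ∧ E N = 0 ∧ ∀ x, x ∉ N → p x

theorem AE.mono {E : PVM X H} {p q : X → Prop} (h : E.AE p) (hpq : ∀ x, p x → q x) : E.AE q := by
  obtain ⟨N, h1, h2, h3⟩ := h
  exact ⟨N, h1, h2, fun x hx => hpq x (h3 x hx)⟩

theorem AE.of_forall {E : PVM X H} {p : X → Prop} (h : ∀ x, p x) : E.AE p :=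
  ⟨∅, MeasurableSet.empty, E.map_empty, fun x _ => h x⟩

theorem AE.and {E : PVM X H} {p q : X → Prop} (hp : E.AE p) (hq : E.AE q) :
    E.AE (fun x => p x ∧ q x) := by
  obtain ⟨N, h1, h2, h3⟩ := hp
  obtain ⟨N', h1', h2', h3'⟩ := hq
  refine ⟨N ∪ N', h1.union h1', ?_, fun x hx => ?_⟩
  · rw [E.eq_zero_iff (h1.union h1')]
    intro v
    exact measure_union_null ((E.eq_zero_iff h1).1 h2 v) ((E.eq_zero_iff h1').1 h2' v)
  · simp only [Set.mem_union, not_or] at hx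
    exact ⟨h3 x hx.1, h3' x hx.2⟩

end PVM

/-! ### Bounded measurable functions and `L^∞` of a projection-valued measure -/

/-- The `*`-algebra `B(X)` of bounded measurable functions `X → ℂ`. -/
def BddMeas (X : Type*) [MeasurableSpace X] : StarSubalgebra ℂ (X → ℂ) where
  carrier := {f | Measurable f ∧ ∃ C : ℝ, ∀ x, ‖f x‖ ≤ C}
  mul_mem' := by
    rintro f g ⟨hf, C, hC⟩ ⟨hg, D, hD⟩
    refine ⟨hf.mul hg, C * D, fun x => ?_⟩
    rw [Pi.mul_apply, norm_mul]
    exact mul_le_mul (hC x) (hD x) (norm_nonneg _) ((norm_nonneg _).trans (hC x))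
  add_mem' := by
    rintro f g ⟨hf, C, hC⟩ ⟨hg, D, hD⟩
    exact ⟨hf.add hg, C + D, fun x => (norm_add_le _ _).trans (add_le_add (hC x) (hD x))⟩
  algebraMap_mem' := fun c => ⟨measurable_const, ‖c‖, fun _ => le_rfl⟩
  star_mem' := by
    rintro f ⟨hf, C, hC⟩
    exact ⟨Complex.continuous_conj.measurable.comp hf, C, fun x => by
      simpa [Pi.star_apply] using hC x⟩

section Linfty

variable {X : Type*} [MeasurableSpace X] {H : Type*} [NormedAddCommGroup H]
  [InnerProductSpace ℂ H] [CompleteSpace H]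

/-- The ideal of bounded measurable functions that vanish `E`-almost everywhere. -/
def nullIdeal (E : PVM X H) : Ideal (BddMeas X) where
  carrier := {f | E.AE (fun x => (f : X → ℂ) x = 0)}
  zero_mem' := .of_forall fun _ => rfl
  add_mem' := fun {f g} hf hg => (hf.and hg).mono fun x hx => by
    change (f : X → ℂ) x + (g : X → ℂ) x = 0
    rw [hx.1, hx.2, add_zero]
  smul_mem' := fun c f hf => hf.mono fun x hx => by
    change (c : X → ℂ) x * (f : X → ℂ) x = 0
    rw [hx, mul_zero]

/-- `L^∞(E)`: bounded measurable functions modulo equality `E`-almost everywhere. -/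
def Linfty (E : PVM X H) : Type _ := BddMeas X ⧸ nullIdeal E

instance (E : PVM X H) : CommRing (Linfty E) := inferInstanceAs (CommRing (BddMeas X ⧸ nullIdeal E))

instance (E : PVM X H) : Algebra ℂ (Linfty E) :=
  inferInstanceAs (Algebra ℂ (BddMeas X ⧸ nullIdeal E))

/-- The canonical projection `π : B(X) → L^∞(E)`. -/
def Linfty.proj (E : PVM X H) : BddMeas X →ₐ[ℂ] Linfty E := Ideal.Quotient.mkₐ ℂ (nullIdeal E)

theorem nullIdeal_le_comap_star (E : PVM X H) :
    nullIdeal E ≤ (nullIdeal E).comap (starRingEnd (BddMeas X)) := fun f hf =>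
  PVM.AE.mono (E := E) hf fun x hx => by
    change star ((f : X → ℂ) x) = 0
    rw [hx, star_zero]

theorem Linfty.proj_surjective (E : PVM X H) : Function.Surjective (Linfty.proj E) :=
  Ideal.Quotient.mk_surjective

/-- Complex conjugation as a ring endomorphism of `L^∞(E)`. -/
def Linfty.conj (E : PVM X H) : Linfty E →+* Linfty E :=
  Ideal.quotientMap (nullIdeal E) (starRingEnd (BddMeas X)) (nullIdeal_le_comap_star E)

theorem Linfty.conj_proj (E : PVM X H) (f : BddMeas X) :
    Linfty.conj E (Linfty.proj E f) = Linfty.proj E (star f) := rfl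

/-- The involution of `L^∞(E)` is complex conjugation. -/
instance (E : PVM X H) : StarRing (Linfty E) where
  star := Linfty.conj E
  star_involutive q := by
    obtain ⟨f, rfl⟩ := Linfty.proj_surjective E q
    rw [Linfty.conj_proj, Linfty.conj_proj, star_star]
  star_mul p q := by rw [map_mul, mul_comm]
  star_add p q := map_add _ p q

theorem Linfty.star_proj (E : PVM X H) (f : BddMeas X) :
    star (Linfty.proj E f) = Linfty.proj E (star f) := rfl

instance (E : PVM X H) : StarModule ℂ (Linfty E) where
  star_smul c q := by
    obtain ⟨f, rfl⟩ := Linfty.proj_surjective E q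
    rw [← map_smul, Linfty.star_proj, Linfty.star_proj, star_smul, map_smul]

/-- The essential supremum of `|f|` with respect to `E`. -/
def PVM.essNorm (E : PVM X H) (f : X → ℂ) : ℝ :=
  sInf {c : ℝ | 0 ≤ c ∧ E.AE (fun x => ‖f x‖ ≤ c)}

/-- The norm of `L^∞(E)`, i.e. the essential supremum with respect to `E`. -/
def Linfty.essNorm (E : PVM X H) : Linfty E → ℝ :=
  Quotient.lift (fun f : BddMeas X => E.essNorm f) (by
    have key : ∀ f g : BddMeas X, f - g ∈ nullIdeal E → ∀ c : ℝ,
        E.AE (fun x => ‖(f : X → ℂ) x‖ ≤ c) → E.AE (fun x => ‖(g : X → ℂ) x‖ ≤ c) := by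
      intro f g h c hf
      refine (PVM.AE.and (E := E) h hf).mono fun x hx => ?_
      have h1 : (f : X → ℂ) x - (g : X → ℂ) x = 0 := hx.1
      rw [← sub_eq_zero.1 h1]
      exact hx.2
    intro f g hfg
    have h : f - g ∈ nullIdeal E := (Submodule.quotientRel_def _).1 hfg
    have h' : g - f ∈ nullIdeal E := by
      rw [← neg_sub]; exact (nullIdeal E).neg_mem h
    unfold PVM.essNorm
    congr 1
    ext c
    exact and_congr_right fun _ => ⟨key f g h c, key g f h' c⟩)

end Linfty

/-! ### The Hilbert space of Hilbert–Schmidt operators -/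

section HilbertSchmidt

/-- The index set of a fixed orthonormal (Hilbert) basis of `K`. -/
def stdIndex (K : Type*) [NormedAddCommGroup K] [InnerProductSpace ℂ K] [CompleteSpace K] :
    Set K := (exists_hilbertBasis ℂ K).choose

/-- A fixed orthonormal (Hilbert) basis of `K`. -/
def stdBasis (K : Type*) [NormedAddCommGroup K] [InnerProductSpace ℂ K] [CompleteSpace K] :
    HilbertBasis (stdIndex K) ℂ K := (exists_hilbertBasis ℂ K).choose_spec.choose

variable (K H : Type*) [NormedAddCommGroup K] [InnerProductSpace ℂ K] [CompleteSpace K]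
  [NormedAddCommGroup H] [InnerProductSpace ℂ H]

/-- The operators `T : K → H` with `∑ᵢ ‖T eᵢ‖² < ∞` for an orthonormal basis `(eᵢ)` of `K`
(this does not depend on the basis). -/
def hsSubmodule : Submodule ℂ (K →L[ℂ] H) where
  carrier := {T | Memℓp (fun i => T (stdBasis K i)) 2}
  zero_mem' := zero_memℓp
  add_mem' := fun h h' => h.add h'
  smul_mem' := fun c _ h => h.const_smul c

/-- The space `𝔖₂(K, H)` of Hilbert–Schmidt operators `K → H`.  It is a type of its own since it
carries the Hilbert–Schmidt norm, not the operator norm. -/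
def HilbertSchmidt : Type _ := hsSubmodule K H

namespace HilbertSchmidt

instance : AddCommGroup (HilbertSchmidt K H) := inferInstanceAs (AddCommGroup (hsSubmodule K H))

instance : Module ℂ (HilbertSchmidt K H) := inferInstanceAs (Module ℂ (hsSubmodule K H))

variable {K H}

/-- The underlying bounded operator of a Hilbert–Schmidt operator. -/
def toCLM (T : HilbertSchmidt K H) : K →L[ℂ] H := Subtype.val (p := (· ∈ hsSubmodule K H)) T

variable (K H)

/-- `T ↦ (T eᵢ)ᵢ`, which identifies `𝔖₂(K, H)` with the Hilbert sum `⨁ᵢ H`. -/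
def toHilbertSum : HilbertSchmidt K H →ₗ[ℂ] lp (fun _ : stdIndex K => H) 2 where
  toFun T := ⟨fun i => T.toCLM (stdBasis K i), Subtype.property (p := (· ∈ hsSubmodule K H)) T⟩
  map_add' _ _ := rfl
  map_smul' _ _ := rfl

theorem toHilbertSum_injective : Function.Injective (toHilbertSum K H) := by
  intro S T h
  refine Subtype.ext (ContinuousLinearMap.ext_on
    ((Submodule.dense_iff_topologicalClosure_eq_top).2 (stdBasis K).dense_span) ?_)
  rintro _ ⟨i, rfl⟩
  exact congrFun (congrArg Subtype.val h) i

instance : NormedAddCommGroup (HilbertSchmidt K H) :=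
  NormedAddCommGroup.induced _ _ (toHilbertSum K H) (toHilbertSum_injective K H)

/-- The Hilbert–Schmidt inner product `⟨S, T⟩ = ∑ᵢ ⟨S eᵢ, T eᵢ⟩ = Tr(S* T)`. -/
instance : InnerProductSpace ℂ (HilbertSchmidt K H) where
  norm_smul_le c T := by
    change ‖toHilbertSum K H (c • T)‖ ≤ ‖c‖ * ‖toHilbertSum K H T‖
    rw [map_smul]; exact norm_smul_le _ _
  inner S T := ⟪toHilbertSum K H S, toHilbertSum K H T⟫_ℂ
  norm_sq_eq_re_inner T := norm_sq_eq_re_inner (𝕜 := ℂ) (toHilbertSum K H T)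
  conj_inner_symm S T := inner_conj_symm (𝕜 := ℂ) (toHilbertSum K H S) (toHilbertSum K H T)
  add_left S T U := by rw [map_add]; exact inner_add_left _ _ _
  smul_left S T c := by rw [map_smul]; exact inner_smul_left _ _ _

theorem inner_eq (S T : HilbertSchmidt K H) :
    ⟪S, T⟫_ℂ = ∑' i, ⟪S.toCLM (stdBasis K i), T.toCLM (stdBasis K i)⟫_ℂ := rfl

variable [CompleteSpace H]

theorem toHilbertSum_surjective : Function.Surjective (toHilbertSum K H) := by
  intro f
  have hle : ∀ (y : H) (i : stdIndex K), ‖⟪f i, y⟫_ℂ‖ ≤ ‖((‖y‖ : ℂ) • f) i‖ := fun y i => by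
    rw [lp.coeFn_smul, Pi.smul_apply, norm_smul, Complex.norm_real, norm_norm, mul_comm]
    exact norm_inner_le_norm _ _
  let g : H → lp (fun _ : stdIndex K => ℂ) 2 := fun y =>
    ⟨fun i => ⟪f i, y⟫_ℂ, (lp.memℓp ((‖y‖ : ℂ) • f)).mono' (hle y)⟩
  let L : H →ₗ[ℂ] K :=
    { toFun := fun y => (stdBasis K).repr.symm (g y)
      map_add' := fun y y' => by
        rw [← map_add]; congr 1; ext i; exact inner_add_right _ _ _
      map_smul' := fun c y => by
        rw [RingHom.id_apply, ← map_smul]; congr 1; ext i; exact inner_smul_right _ _ _ }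
  let S : H →L[ℂ] K := L.mkContinuous ‖f‖ fun y => by
    change ‖(stdBasis K).repr.symm (g y)‖ ≤ _
    rw [LinearIsometryEquiv.norm_map]
    refine (lp.norm_mono (by norm_num) (y := (‖y‖ : ℂ) • f) (hle y)).trans ?_
    rw [norm_smul, Complex.norm_real, norm_norm, mul_comm]
  have hS : ∀ i, ContinuousLinearMap.adjoint S (stdBasis K i) = f i := fun i => by
    refine ext_inner_right ℂ fun y => ?_
    rw [ContinuousLinearMap.adjoint_inner_left, ← HilbertBasis.repr_apply_apply]
    change (stdBasis K).repr ((stdBasis K).repr.symm (g y)) i = _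
    rw [LinearIsometryEquiv.apply_symm_apply]
  refine ⟨(⟨ContinuousLinearMap.adjoint S, ?_⟩ : hsSubmodule K H), ?_⟩
  · change Memℓp (fun i => ContinuousLinearMap.adjoint S (stdBasis K i)) 2
    simp_rw [hS]
    exact lp.memℓp f
  · ext i
    exact hS i

instance : CompleteSpace (HilbertSchmidt K H) := by
  have hi : Isometry (toHilbertSum K H) := AddMonoidHomClass.isometry_of_norm _ fun _ => rfl
  have := (IsometryEquiv.mk (Equiv.ofBijective _
    ⟨toHilbertSum_injective K H, toHilbertSum_surjective K H⟩) hi)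
  exact this.completeSpace

end HilbertSchmidt

end HilbertSchmidt

/-! ### The double projection-valued measure -/

section Double

variable {X : Type*} [MeasurableSpace X] {Y : Type*} [MeasurableSpace Y]
  {H : Type*} [NormedAddCommGroup H] [InnerProductSpace ℂ H] [CompleteSpace H]
  {K : Type*} [NormedAddCommGroup K] [InnerProductSpace ℂ K] [CompleteSpace K]

/-- `G` is a projection-valued measure on `X × Y` (with the product `σ`-algebra), acting on the
Hilbert–Schmidt operators `K → H`, with `G(Γ × Δ) T = E(Γ) T F(Δ)` on measurable rectangles. -/
def IsDoublePVM (E : PVM X H) (F : PVM Y K) (G : PVM (X × Y) (HilbertSchmidt K H)) : Prop :=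
  ∀ (Γ : Set X) (Δ : Set Y), MeasurableSet Γ → MeasurableSet Δ → ∀ T : HilbertSchmidt K H,
    (G (Γ ×ˢ Δ) T).toCLM = E Γ ∘L T.toCLM ∘L F Δ

end Double

/-! ### Integral decompositions -/

/-- A finite positive measure space `(Z, ν)` together with bounded measurable functions
`α : X × Z → ℂ` and `β : Y × Z → ℂ`. -/
structure IntegralData (X : Type uX) [MeasurableSpace X] (Y : Type uY) [MeasurableSpace Y] where
  Z : Type uZ
  [measurableSpace : MeasurableSpace Z]
  ν : Measure Z
  [isFiniteMeasure : IsFiniteMeasure ν]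
  α : X × Z → ℂ
  β : Y × Z → ℂ
  α_mem : α ∈ BddMeas (X × Z)
  β_mem : β ∈ BddMeas (Y × Z)

attribute [instance] IntegralData.measurableSpace IntegralData.isFiniteMeasure

section Spaces

variable {X : Type uX} [MeasurableSpace X] {Y : Type uY} [MeasurableSpace Y]
  {H : Type*} [NormedAddCommGroup H] [InnerProductSpace ℂ H] [CompleteSpace H]
  {K : Type*} [NormedAddCommGroup K] [InnerProductSpace ℂ K] [CompleteSpace K]

/-- The function `(x, y) ↦ ∫ α(x, z) β(y, z) dν(z)`. -/
def IntegralData.value (D : IntegralData.{uX, uY, uZ} X Y) (p : X × Y) : ℂ :=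
  ∫ z, D.α (p.1, z) * D.β (p.2, z) ∂D.ν

/-- `D` is a strict decomposition of `φ`: the integral formula holds everywhere. -/
def IntegralData.IsStrictDecomposition (D : IntegralData.{uX, uY, uZ} X Y) (φ : X × Y → ℂ) : Prop :=
  ∀ p, φ p = D.value p

/-- `D` is a decomposition of `φ`: the integral formula holds `G`-almost everywhere. -/
def IntegralData.IsDecomposition (D : IntegralData.{uX, uY, uZ} X Y)
    (G : PVM (X × Y) (HilbertSchmidt K H)) (φ : X × Y → ℂ) : Prop :=
  G.AE (fun p => φ p = D.value p)

/-- `sup_{v ∈ H, w ∈ K} ∫ ‖α_z‖_{L^∞(E_{v,v})} ‖β_z‖_{L^∞(F_{w,w})} dν(z)`. -/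
def IntegralData.cost (D : IntegralData.{uX, uY, uZ} X Y) (E : PVM X H) (F : PVM Y K) : ℝ≥0∞ :=
  ⨆ (v : H) (w : K), ∫⁻ z, eLpNorm (fun x => D.α (x, z)) ∞ (E.diagMeasure v) *
    eLpNorm (fun y => D.β (y, z)) ∞ (F.diagMeasure w) ∂D.ν

variable (X Y) in
/-- `𝔐₀₀`: the functions with a strict decomposition. -/
def M00 : Set (X × Y → ℂ) :=
  {φ | ∃ D : IntegralData.{uX, uY, uZ} X Y, D.IsStrictDecomposition φ}

/-- `𝔐 = π(𝔐₀₀) ⊆ L^∞(G)`. -/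
def MQuot (G : PVM (X × Y) (HilbertSchmidt K H)) : Set (Linfty G) :=
  Linfty.proj G '' {φ | (φ : X × Y → ℂ) ∈ M00.{uX, uY, uZ} X Y}

/-- `𝔐₀ = π⁻¹(𝔐)`, a set of bounded measurable functions. -/
def M0 (G : PVM (X × Y) (HilbertSchmidt K H)) : Set (BddMeas (X × Y)) :=
  Linfty.proj G ⁻¹' MQuot.{uX, uY, uZ} G

/-- `‖φ‖_{𝔐₀}`, the infimum over all decompositions of `φ`, as an extended nonnegative real. -/
def M0norm (E : PVM X H) (F : PVM Y K) (G : PVM (X × Y) (HilbertSchmidt K H))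
    (φ : BddMeas (X × Y)) : ℝ≥0∞ :=
  ⨅ (D : IntegralData.{uX, uY, uZ} X Y) (_ : D.IsDecomposition G φ), D.cost E F

end Spaces

end

/-! The double measure is controlled by its quadratic form on rank-one operators `k ↦ ⟨w, k⟩ v`:
there it must be the scalar product measure `E_{v,v} × F_{w,w}`. Polarising in `v` and then in `w`
shows that this determines an operator on Hilbert–Schmidt operators (`ext_inner_rankOne`), which
gives uniqueness. Existence is an induction over the product σ-algebra (`exists_projection_mul`): a
disjoint union requires the projections built so far to be orthogonal, so the induction also carries
the rule that products of projections represent intersections. Consequently "`G`-a.e." means a.e.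
for every `E_{v,v} × F_{w,w}`, and scalar Fubini arguments apply.

The algebraic operations act on decompositions: sums use disjoint unions of the spaces `Z`, products
use product spaces, and the costs are additive and multiplicative up to `≤`. The bound `|φ| ≤ ∫
‖α_z‖ ‖β_z‖ dν` a.e. compares the norm with the essential supremum, so the seminorm vanishes only on
null functions.

Completeness rests on `exists_normalized`: up to `G`-null sets, any decomposition can be replaced by
one with `|α|, |β| ≤ 1` and total mass equal to its cost. The difficulty is that the essential
suprema depend on `v` and `w`, and without separability no single vector need dominate all
`E_{v,v}`. Countably many are dominated by one (`exists_absolutelyContinuous`), so the supremum in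
the cost is attained at some pair; passing to larger measures cannot increase the integral, so it
leaves the product of the two norms unchanged for `ν`-a.e. `z`. Dividing by the norms at this pair
is therefore harmless for every other pair. Normalised decompositions with summable masses can be
glued over a countable disjoint union, which sums an absolutely convergent series. -/

noncomputable section

set_option linter.unusedSectionVars false

/-! ### Orthogonal projections on Hilbert spaces -/

section Projections

variable {H : Type*} [NormedAddCommGroup H] [InnerProductSpace ℂ H] [CompleteSpace H]

namespace IsStarProjection

theorem apply_apply {P : H →L[ℂ] H} (hP : IsStarProjection P) (v : H) : P (P v) = P v :=
  congrArg (fun T : H →L[ℂ] H => T v) hP.isIdempotentElem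

theorem inner_apply_left {P : H →L[ℂ] H} (hP : IsStarProjection P) (v w : H) :
    ⟪P v, w⟫_ℂ = ⟪v, P w⟫_ℂ := by
  have h : ContinuousLinearMap.adjoint P = P := hP.isSelfAdjoint
  conv_lhs => rw [← h]
  exact ContinuousLinearMap.adjoint_inner_left _ _ _

theorem inner_apply_self {P : H →L[ℂ] H} (hP : IsStarProjection P) (v : H) :
    ⟪v, P v⟫_ℂ = ((‖P v‖ ^ 2 : ℝ) : ℂ) := by
  rw [← hP.apply_apply v, ← hP.inner_apply_left, hP.apply_apply, inner_self_eq_norm_sq_to_K]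
  norm_cast

theorem norm_apply_le {P : H →L[ℂ] H} (hP : IsStarProjection P) (v : H) : ‖P v‖ ≤ ‖v‖ := by
  have h : ‖P v‖ ^ 2 ≤ ‖v‖ * ‖P v‖ := by
    have := norm_inner_le_norm (𝕜 := ℂ) v (P v)
    rwa [hP.inner_apply_self, Complex.norm_real, Real.norm_of_nonneg (by positivity)] at this
  rcases (norm_nonneg (P v)).eq_or_lt with h0 | h0
  · rw [← h0]; positivity
  · nlinarith

/-- If the sum of two projections is a projection, then they are orthogonal. -/
theorem mul_eq_zero_of_add {P Q : H →L[ℂ] H} (hP : IsStarProjection P) (hQ : IsStarProjection Q)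
    (h : IsStarProjection (P + Q)) : P * Q = 0 := by
  ext v
  -- Evaluate the form of `P + Q` at `Q v`. Since `P + Q` is a contraction, `‖P Q v‖² + ‖Q v‖² ≤ ‖Q
  -- v‖²`.
  have h1 : ‖P (Q v)‖ ^ 2 + ‖Q (Q v)‖ ^ 2 = ‖(P + Q) (Q v)‖ ^ 2 := by
    have := h.inner_apply_self (Q v)
    rw [add_apply, inner_add_right, hP.inner_apply_self,
      hQ.inner_apply_self] at this
    exact_mod_cast this
  have h2 := h.norm_apply_le (Q v)
  rw [hQ.apply_apply] at h1
  have h3 : ‖P (Q v)‖ ^ 2 ≤ 0 := by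
    nlinarith [norm_nonneg ((P + Q) (Q v)), norm_nonneg (Q v)]
  have h4 : ‖P (Q v)‖ = 0 := pow_eq_zero_iff two_ne_zero |>.1 (le_antisymm h3 (by positivity))
  simpa using h4

theorem add_of_mul_eq_zero {P Q : H →L[ℂ] H} (hP : IsStarProjection P) (hQ : IsStarProjection Q)
    (h : P * Q = 0) : IsStarProjection (P + Q) := by
  have h' : Q * P = 0 := by
    have := congrArg star h
    rwa [star_mul, star_zero, hP.isSelfAdjoint.star_eq, hQ.isSelfAdjoint.star_eq] at this
  refine ⟨?_, hP.isSelfAdjoint.add hQ.isSelfAdjoint⟩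
  rw [IsIdempotentElem, add_mul, mul_add, mul_add, h, h', hP.isIdempotentElem.eq,
    hQ.isIdempotentElem.eq, add_zero, zero_add]

/-- Two operators with the same quadratic form are equal. -/
theorem _root_.ContinuousLinearMap.ext_inner_self {P Q : H →L[ℂ] H}
    (h : ∀ v, ⟪v, P v⟫_ℂ = ⟪v, Q v⟫_ℂ) : P = Q := by
  refine ContinuousLinearMap.coe_injective ((ext_inner_map _ _).1 fun v => ?_)
  have := congrArg (starRingEnd ℂ) (h v)
  rwa [inner_conj_symm, inner_conj_symm] at this

/-- Pairwise orthogonal projections have a sum, in the strong operator topology, that is again a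
projection. -/
theorem exists_tendsto_sum {P : ℕ → H →L[ℂ] H} (hP : ∀ n, IsStarProjection (P n))
    (horth : Pairwise fun m n => P m * P n = 0) :
    ∃ Q : H →L[ℂ] H, IsStarProjection Q ∧
      ∀ v, Filter.Tendsto (fun n => ∑ i ∈ Finset.range n, P i v) Filter.atTop (nhds (Q v)) := by
  have hmul : ∀ n m, n ≤ m → (∑ i ∈ Finset.range n, P i) * P m = 0 := fun n m hnm => by
    rw [Finset.sum_mul]
    refine Finset.sum_eq_zero fun i hi => horth ?_
    have := Finset.mem_range.1 hi
    omega
  have hS : ∀ n, IsStarProjection (∑ i ∈ Finset.range n, P i) := fun n => by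
    induction n with
    | zero => simp
    | succ n ih =>
      rw [Finset.sum_range_succ]
      exact ih.add_of_mul_eq_zero (hP n) (hmul n n le_rfl)
  choose U hU hSU using fun n => isStarProjection_iff_eq_starProjection.1 (hS n)
  -- The partial sums project onto increasing subspaces, so they converge strongly to the projection
  -- onto the closure of their union.
  have hmono : Monotone U := monotone_nat_of_le_succ fun n x hx => by
    rw [← Submodule.starProjection_eq_self_iff, ← hSU] at hx ⊢
    rw [Finset.sum_range_succ, add_apply, hx]
    have h0 : P n * (∑ i ∈ Finset.range n, P i) = 0 := by
      have := congrArg star (hmul n n le_rfl)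
      rwa [star_mul, star_zero, (hS n).isSelfAdjoint.star_eq, (hP n).isSelfAdjoint.star_eq] at this
    have := congrArg (fun T : H →L[ℂ] H => T x) h0
    simp only [mul_apply_eq_comp, hx, zero_apply] at this
    rw [this, add_zero]
  have : (⨆ i, U i).topologicalClosure.HasOrthogonalProjection :=
    have : CompleteSpace (⨆ i, U i).topologicalClosure :=
      (Submodule.isClosed_topologicalClosure _).completeSpace_coe
    inferInstance
  refine ⟨_, isStarProjection_starProjection (U := (⨆ i, U i).topologicalClosure), fun v => ?_⟩
  have := Submodule.starProjection_tendsto_closure_iSup U hmono v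
  simp only [← hSU, sum_apply] at this
  exact this

/-- On the diagonal the terms are `‖P n v‖² ≥ 0`, so convergence of the ordered partial sums is
already unconditional. Polarisation carries this to arbitrary `v` and `w`. -/
theorem hasSum_inner_of_tendsto {P : ℕ → H →L[ℂ] H} (hP : ∀ n, IsStarProjection (P n))
    {Q : H →L[ℂ] H} (hQ : IsStarProjection Q)
    (h : ∀ v, Filter.Tendsto (fun n => ∑ i ∈ Finset.range n, P i v) Filter.atTop (nhds (Q v)))
    (v w : H) : HasSum (fun n => ⟪v, P n w⟫_ℂ) ⟪v, Q w⟫_ℂ := by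
  have hd : ∀ v, HasSum (fun n => ⟪P n v, v⟫_ℂ) ⟪Q v, v⟫_ℂ := fun v => by
    simp only [(hP _).inner_apply_left, hQ.inner_apply_left, (hP _).inner_apply_self,
      hQ.inner_apply_self]
    rw [Complex.hasSum_ofReal, hasSum_iff_tendsto_nat_of_nonneg fun _ => by positivity]
    have h1 : Filter.Tendsto (fun n => (⟪v, ∑ i ∈ Finset.range n, P i v⟫_ℂ).re) Filter.atTop
        (nhds (⟪v, Q v⟫_ℂ).re) :=
      (Complex.continuous_re.tendsto _).comp (tendsto_const_nhds.inner (h v))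
    simp only [inner_sum, (hP _).inner_apply_self, hQ.inner_apply_self, Complex.re_sum,
      Complex.ofReal_re] at h1
    exact h1
  simp only [← (hP _).inner_apply_left, ← hQ.inner_apply_left]
  have h1 := ((((hd (v + w)).sub (hd (v - w))).sub ((hd (v + Complex.I • w)).mul_left Complex.I)).add
    ((hd (v - Complex.I • w)).mul_left Complex.I)).div_const 4
  have h2 : ∀ T : H →L[ℂ] H, _ := fun T => inner_map_polarization' (T : H →ₗ[ℂ] H) v w
  simp only [ContinuousLinearMap.coe_coe] at h2
  simp only [h2]
  exact h1

end IsStarProjection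

end Projections

/-! ### Elementary properties of projection-valued measures -/

namespace PVM

variable {X : Type*} [MeasurableSpace X] {H : Type*} [NormedAddCommGroup H]
  [InnerProductSpace ℂ H] [CompleteSpace H]

theorem ext_of_measurable {E E' : PVM X H} (h : ∀ s, MeasurableSet s → E s = E' s) : E = E' := by
  have : E.toFun = E'.toFun := by
    funext s
    by_cases hs : MeasurableSet s
    · exact h s hs
    · rw [E.not_measurable' s hs, E'.not_measurable' s hs]
  cases E; cases E'; congr

theorem diagMeasure_apply_norm (E : PVM X H) (v : H) {s : Set X} (hs : MeasurableSet s) :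
    E.diagMeasure v s = ENNReal.ofReal (‖E s v‖ ^ 2) := by
  rw [E.diagMeasure_apply v hs, E.inner_self_eq, Complex.ofReal_re]

instance (E : PVM X H) (v : H) : IsFiniteMeasure (E.diagMeasure v) :=
  ⟨by rw [E.diagMeasure_apply_norm v .univ]; exact ENNReal.ofReal_lt_top⟩

theorem diagMeasure_eq_zero_iff (E : PVM X H) (v : H) {s : Set X} (hs : MeasurableSet s) :
    E.diagMeasure v s = 0 ↔ E s v = 0 := by
  rw [E.diagMeasure_apply_norm v hs, ENNReal.ofReal_eq_zero, ← norm_eq_zero (a := E s v)]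
  constructor
  · exact fun h => pow_eq_zero_iff two_ne_zero |>.1 (le_antisymm h (by positivity))
  · intro h; rw [h]; norm_num

theorem real_diagMeasure (E : PVM X H) (v : H) {s : Set X} (hs : MeasurableSet s) :
    (E.diagMeasure v).real s = ‖E s v‖ ^ 2 := by
  rw [measureReal_def, E.diagMeasure_apply_norm v hs, ENNReal.toReal_ofReal (by positivity)]

theorem inner_self_eq_real_diagMeasure (E : PVM X H) (v : H) {s : Set X} (hs : MeasurableSet s) :
    ⟪v, E s v⟫_ℂ = ((E.diagMeasure v).real s : ℂ) := by
  rw [E.real_diagMeasure v hs, E.inner_self_eq]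

theorem union (E : PVM X H) {s t : Set X} (hs : MeasurableSet s) (ht : MeasurableSet t)
    (hd : Disjoint s t) : E (s ∪ t) = E s + E t := by
  refine ContinuousLinearMap.ext_inner_self fun v => ?_
  rw [add_apply, inner_add_right, E.inner_self_eq_real_diagMeasure v (hs.union ht),
    E.inner_self_eq_real_diagMeasure v hs, E.inner_self_eq_real_diagMeasure v ht,
    measureReal_union hd ht]
  push_cast; rfl

theorem mul_of_disjoint (E : PVM X H) {s t : Set X} (hs : MeasurableSet s) (ht : MeasurableSet t)
    (hd : Disjoint s t) : E s * E t = 0 :=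
  (E.isStarProjection s).mul_eq_zero_of_add (E.isStarProjection t)
    (E.union hs ht hd ▸ E.isStarProjection (s ∪ t))

theorem inter (E : PVM X H) {s t : Set X} (hs : MeasurableSet s) (ht : MeasurableSet t) :
    E (s ∩ t) = E s * E t := by
  have h1 : E s = E (s ∩ t) + E (s \ t) := by
    rw [← E.union (hs.inter ht) (hs.diff ht) Set.disjoint_sdiff_inter.symm, Set.inter_union_sdiff]
  have h2 : E t = E (s ∩ t) + E (t \ s) := by
    rw [Set.inter_comm, ← E.union (ht.inter hs) (ht.diff hs) Set.disjoint_sdiff_inter.symm,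
      Set.inter_union_sdiff]
  have d1 : Disjoint (s ∩ t) (t \ s) := Set.disjoint_left.2 fun x hx hx' => hx'.2 hx.1
  have d2 : Disjoint (s \ t) (s ∩ t) := Set.disjoint_left.2 fun x hx hx' => hx.2 hx'.2
  have d3 : Disjoint (s \ t) (t \ s) := Set.disjoint_left.2 fun x hx hx' => hx.2 hx'.1
  rw [h1, h2, add_mul, mul_add, mul_add, (E.isStarProjection _).isIdempotentElem.eq,
    E.mul_of_disjoint (hs.inter ht) (ht.diff hs) d1, E.mul_of_disjoint (hs.diff ht) (hs.inter ht) d2,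
    E.mul_of_disjoint (hs.diff ht) (ht.diff hs) d3]
  simp

theorem apply_apply (E : PVM X H) {s t : Set X} (hs : MeasurableSet s) (ht : MeasurableSet t)
    (v : H) : E s (E t v) = E (s ∩ t) v := by
  rw [E.inter hs ht]; rfl

/-- Cutting a vector by `E s` restricts its scalar measure to `s`; this is what turns products with
rectangle projections into intersections. -/
theorem diagMeasure_apply_vector (E : PVM X H) (v : H) {s : Set X} (hs : MeasurableSet s) :
    E.diagMeasure (E s v) = (E.diagMeasure v).restrict s := by
  ext t ht
  rw [Measure.restrict_apply ht, E.diagMeasure_apply_norm _ ht,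
    E.diagMeasure_apply_norm _ (ht.inter hs), E.apply_apply ht hs]

/-- Countably many of the measures `E_{v,v}` are dominated by a single one. -/
theorem exists_absolutelyContinuous (E : PVM X H) (v : ℕ → H) :
    ∃ u : H, ∀ n, E.diagMeasure (v n) ≪ E.diagMeasure u := by
  -- The sum of the measures may be infinite; `μ` is a finite measure that still dominates every
  -- `E_{v n, v n}`, and `f n` are the densities.
  set μ : Measure X := (Measure.sum fun n => E.diagMeasure (v n)).toFinite with hμ
  have hac : ∀ n, E.diagMeasure (v n) ≪ μ := fun n =>
    (Measure.absolutelyContinuous_sum_right n Measure.AbsolutelyContinuous.rfl).trans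
      (absolutelyContinuous_toFinite _)
  set f : ℕ → X → ℝ≥0∞ := fun n => (E.diagMeasure (v n)).rnDeriv μ with hf
  have hfm : ∀ n, Measurable (f n) := fun n => Measure.measurable_rnDeriv _ _
  have hd : ∀ n, μ.withDensity (f n) = E.diagMeasure (v n) := fun n =>
    Measure.withDensity_rnDeriv_eq _ _ (hac n)
  have hBm : ∀ n, MeasurableSet {x | f n x ≠ 0} := fun n => (hfm n) (measurableSet_singleton 0).compl
  -- The supports of the densities are made disjoint so that the pieces `E (A n) (v n)` of the
  -- dominating vector are mutually orthogonal and each can be recovered from the sum.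
  set A : ℕ → Set X := disjointed fun n => {x | f n x ≠ 0} with hA
  have hAm : ∀ n, MeasurableSet (A n) := fun n => MeasurableSet.disjointed hBm n
  -- Positive weights that only ensure norm convergence; the `1 +` covers `v n = 0`.
  set c : ℕ → ℝ := fun n => (1 / 2) ^ n / (1 + ‖v n‖) with hc
  have hcpos : ∀ n, 0 < c n := fun n => by positivity
  have hsum : Summable fun n => (c n : ℂ) • E (A n) (v n) := by
    refine Summable.of_norm_bounded summable_geometric_two fun n => ?_
    rw [norm_smul, Complex.norm_real, Real.norm_of_nonneg (hcpos n).le]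
    have h1 := (E.isStarProjection (A n)).norm_apply_le (v n)
    calc c n * ‖E (A n) (v n)‖ ≤ c n * (1 + ‖v n‖) :=
          mul_le_mul_of_nonneg_left (h1.trans (by linarith)) (hcpos n).le
      _ = (1 / 2) ^ n := div_mul_cancel₀ _ (by positivity)
  refine ⟨∑' n, (c n : ℂ) • E (A n) (v n), fun k => Measure.AbsolutelyContinuous.mk
    fun s hs hs0 => ?_⟩
  rw [E.diagMeasure_eq_zero_iff _ hs] at hs0
  have h1 : ∀ m, E (s ∩ A m) (v m) = 0 := fun m => by
    have h2 : E (A m) (E s (∑' n, (c n : ℂ) • E (A n) (v n))) = 0 := by rw [hs0, map_zero]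
    rw [E.apply_apply (hAm m) hs, ContinuousLinearMap.map_tsum _ hsum, tsum_eq_single m] at h2
    · rw [map_smul, E.apply_apply ((hAm m).inter hs) (hAm m)] at h2
      have h3 := (smul_eq_zero.1 h2).resolve_left (by exact_mod_cast (hcpos m).ne')
      rwa [Set.inter_right_comm, Set.inter_self, Set.inter_comm] at h3
    · intro n hn
      have hdis : Disjoint (A m) (A n) := disjoint_disjointed _ hn.symm
      rw [map_smul, E.apply_apply ((hAm m).inter hs) (hAm n), Set.inter_right_comm,
        hdis.inter_eq, Set.empty_inter, E.map_empty]
      simp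
  -- On `A m` the density `f m` does not vanish, so a set null for `v m` is null for `μ`.
  have h2 : ∀ m, μ (s ∩ A m) = 0 := fun m => by
    have h3 := (E.diagMeasure_eq_zero_iff (v m) (hs.inter (hAm m))).2 (h1 m)
    rw [← hd m, withDensity_apply _ (hs.inter (hAm m)),
      lintegral_eq_zero_iff (hfm m), Filter.EventuallyEq, ae_restrict_iff' (hs.inter (hAm m))] at h3
    refine measure_mono_null (fun x hx => ?_) (ae_iff.1 h3)
    exact fun h => disjointed_subset _ _ hx.2 (h hx)
  have h3 : μ (s ∩ ⋃ n, {x | f n x ≠ 0}) = 0 := by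
    rw [← iUnion_disjointed, Set.inter_iUnion]
    exact measure_iUnion_null h2
  -- Off the union of the supports, the density of `v k` is zero.
  have h4 : E.diagMeasure (v k) (s ∩ (⋃ n, {x | f n x ≠ 0})ᶜ) = 0 := by
    have hm := hs.inter (MeasurableSet.iUnion hBm).compl
    rw [← hd k, withDensity_apply _ hm, setLIntegral_eq_zero_iff hm (hfm k)]
    refine .of_forall fun x hx => ?_
    by_contra h
    exact hx.2 (Set.mem_iUnion.2 ⟨k, h⟩)
  rw [← Set.inter_union_compl s (⋃ n, {x | f n x ≠ 0})]
  exact measure_union_null (hac k h3) h4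

end PVM

/-! ### Rank-one operators and two-sided multiplication on Hilbert–Schmidt operators -/

section HilbertSchmidtOperators

variable {H : Type*} [NormedAddCommGroup H] [InnerProductSpace ℂ H]
  {K : Type*} [NormedAddCommGroup K] [InnerProductSpace ℂ K]

theorem HilbertBasis.tsum_ofReal_norm_inner_sq {ι : Type*} (b : HilbertBasis ι ℂ H) (x : H) :
    ∑' i, ENNReal.ofReal (‖⟪b i, x⟫_ℂ‖ ^ 2) = ENNReal.ofReal (‖x‖ ^ 2) := by
  have h1 := Complex.hasSum_re (b.hasSum_inner_mul_inner x x)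
  have h2 : ∀ i, (⟪x, b i⟫_ℂ * ⟪b i, x⟫_ℂ).re = ‖⟪b i, x⟫_ℂ‖ ^ 2 := fun i => by
    rw [← inner_conj_symm x (b i), ← Complex.normSq_eq_conj_mul_self, Complex.ofReal_re,
      Complex.normSq_eq_norm_sq]
  have h3 : (⟪x, x⟫_ℂ).re = ‖x‖ ^ 2 := (norm_sq_eq_re_inner (𝕜 := ℂ) x).symm
  simp only [h2, h3] at h1
  rw [← h1.tsum_eq, ENNReal.ofReal_tsum_of_nonneg (fun _ => by positivity) h1.summable]

variable [CompleteSpace H] [CompleteSpace K]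

/-- The sum `∑ᵢ ‖T eᵢ‖²`, which is finite if and only if `T` is a Hilbert–Schmidt operator. -/
def hsEnergy (T : K →L[ℂ] H) : ℝ≥0∞ := ∑' i, ENNReal.ofReal (‖T (stdBasis K i)‖ ^ 2)

theorem mem_hsSubmodule_iff (T : K →L[ℂ] H) : T ∈ hsSubmodule K H ↔ hsEnergy T ≠ ∞ := by
  have h : T ∈ hsSubmodule K H ↔ Summable fun i => ‖T (stdBasis K i)‖ ^ 2 := by
    change Memℓp _ _ ↔ _
    rw [memℓp_gen_iff (by norm_num)]
    norm_num
  rw [h]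
  constructor
  · intro hs
    rw [hsEnergy, ← ENNReal.ofReal_tsum_of_nonneg (fun _ => by positivity) hs]
    exact ENNReal.ofReal_ne_top
  · intro hs
    refine (ENNReal.summable_toReal hs).congr fun i => ?_
    rw [ENNReal.toReal_ofReal (by positivity)]

/-- Both sides are double sums of squared matrix coefficients of `T`; with values in `ℝ≥0∞` the
order of summation may be exchanged without a summability hypothesis. -/
theorem hsEnergy_adjoint (T : K →L[ℂ] H) :
    hsEnergy (ContinuousLinearMap.adjoint T) = hsEnergy T := by
  unfold hsEnergy
  simp_rw [← (stdBasis K).tsum_ofReal_norm_inner_sq (ContinuousLinearMap.adjoint T _),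
    ← (stdBasis H).tsum_ofReal_norm_inner_sq (T _)]
  rw [ENNReal.tsum_comm]
  simp_rw [ContinuousLinearMap.adjoint_inner_right, norm_inner_symm (T _)]

theorem hsEnergy_comp_left_le (A : H →L[ℂ] H) (T : K →L[ℂ] H) :
    hsEnergy (A ∘L T) ≤ ENNReal.ofReal (‖A‖ ^ 2) * hsEnergy T := by
  unfold hsEnergy
  rw [← ENNReal.tsum_mul_left]
  refine ENNReal.tsum_le_tsum fun i => ?_
  rw [← ENNReal.ofReal_mul (by positivity), ← mul_pow]
  exact ENNReal.ofReal_le_ofReal (pow_le_pow_left₀ (norm_nonneg _) (A.le_opNorm _) 2)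

/-- Right multiplication does not act on the values at the basis vectors one by one; taking adjoints
reduces it to left multiplication. -/
theorem hsEnergy_comp_right_le (T : K →L[ℂ] H) (B : K →L[ℂ] K) :
    hsEnergy (T ∘L B) ≤ ENNReal.ofReal (‖B‖ ^ 2) * hsEnergy T := by
  rw [← hsEnergy_adjoint, ContinuousLinearMap.adjoint_comp, ← hsEnergy_adjoint T,
    ← (ContinuousLinearMap.adjoint (𝕜 := ℂ) (E := K) (F := K)).norm_map B]
  exact hsEnergy_comp_left_le _ _

theorem hsEnergy_rankOne_ne_top (v : H) (w : K) :
    hsEnergy (InnerProductSpace.rankOne ℂ v w) ≠ ∞ := by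
  have h : hsEnergy (InnerProductSpace.rankOne ℂ v w) =
      ENNReal.ofReal (‖v‖ ^ 2) * ENNReal.ofReal (‖w‖ ^ 2) := by
    rw [← (stdBasis K).tsum_ofReal_norm_inner_sq w, ← ENNReal.tsum_mul_left]
    refine tsum_congr fun i => ?_
    rw [← ENNReal.ofReal_mul (by positivity), ← mul_pow, InnerProductSpace.rankOne_apply, norm_smul,
      norm_inner_symm, mul_comm]
  rw [h]
  exact ENNReal.mul_ne_top ENNReal.ofReal_ne_top ENNReal.ofReal_ne_top

namespace HilbertSchmidt

theorem toCLM_injective : Function.Injective (toCLM : HilbertSchmidt K H → K →L[ℂ] H) :=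
  Subtype.val_injective

theorem ofReal_norm_sq (T : HilbertSchmidt K H) :
    ENNReal.ofReal (‖T‖ ^ 2) = hsEnergy T.toCLM := by
  have h0 := lp.norm_rpow_eq_tsum (p := 2) (by norm_num) (toHilbertSum K H T)
  have h1 : Summable fun i => ‖T.toCLM (stdBasis K i)‖ ^ (2 : ℝ≥0∞).toReal :=
    (memℓp_gen_iff (by norm_num)).1 (Subtype.property (p := (· ∈ hsSubmodule K H)) T)
  have h2 : ‖T‖ ^ (2 : ℝ≥0∞).toReal = ∑' i, ‖T.toCLM (stdBasis K i)‖ ^ (2 : ℝ≥0∞).toReal := h0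
  simp only [ENNReal.toReal_ofNat, Real.rpow_ofNat] at h1 h2
  rw [h2, hsEnergy, ENNReal.ofReal_tsum_of_nonneg (fun _ => by positivity) h1]

/-- The rank-one operator `k ↦ ⟨w, k⟩ v`. -/
def rankOne (v : H) (w : K) : HilbertSchmidt K H :=
  (⟨InnerProductSpace.rankOne ℂ v w, (mem_hsSubmodule_iff _).2 (hsEnergy_rankOne_ne_top v w)⟩ :
    hsSubmodule K H)

theorem rankOne_toCLM_apply (v : H) (w k : K) : (rankOne v w).toCLM k = ⟪w, k⟫_ℂ • v := rfl

theorem inner_rankOne_left (v : H) (w : K) (S : HilbertSchmidt K H) :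
    ⟪rankOne v w, S⟫_ℂ = ⟪v, S.toCLM w⟫_ℂ := by
  rw [inner_eq]
  refine (HasSum.tsum_eq ?_)
  have h := ((stdBasis K).hasSum_repr w).mapL ((innerSL ℂ v).comp S.toCLM)
  simpa [rankOne_toCLM_apply, inner_smul_left, HilbertBasis.repr_apply_apply, mul_comm] using h

theorem inner_rankOne_rankOne (v v' : H) (w w' : K) :
    ⟪rankOne v w, rankOne v' w'⟫_ℂ = ⟪w', w⟫_ℂ * ⟪v, v'⟫_ℂ := by
  rw [inner_rankOne_left, rankOne_toCLM_apply, inner_smul_right]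

theorem norm_rankOne (v : H) (w : K) : ‖rankOne v w‖ = ‖v‖ * ‖w‖ := by
  have h : ((‖rankOne v w‖ ^ 2 : ℝ) : ℂ) = (((‖v‖ * ‖w‖) ^ 2 : ℝ) : ℂ) := by
    have := inner_rankOne_rankOne v v w w
    rw [inner_self_eq_norm_sq_to_K, inner_self_eq_norm_sq_to_K, inner_self_eq_norm_sq_to_K] at this
    push_cast
    rw [mul_pow, mul_comm]
    exact this
  exact (pow_left_inj₀ (norm_nonneg _) (by positivity) two_ne_zero).1 (Complex.ofReal_injective h)

theorem eq_zero_of_inner_rankOne {S : HilbertSchmidt K H}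
    (h : ∀ (v : H) (w : K), ⟪rankOne v w, S⟫_ℂ = 0) : S = 0 := by
  refine toCLM_injective (ContinuousLinearMap.ext fun w => ext_inner_left ℂ fun v => ?_)
  rw [← inner_rankOne_left, h]
  exact (inner_zero_right v).symm

theorem rankOne_add_left (v v' : H) (w : K) :
    rankOne (v + v') w = rankOne v w + rankOne v' w :=
  toCLM_injective (ContinuousLinearMap.ext fun _ => smul_add _ _ _)

theorem rankOne_add_right (v : H) (w w' : K) :
    rankOne v (w + w') = rankOne v w + rankOne v w' :=
  toCLM_injective (ContinuousLinearMap.ext fun k => by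
    change ⟪w + w', k⟫_ℂ • v = ⟪w, k⟫_ℂ • v + ⟪w', k⟫_ℂ • v
    rw [inner_add_left, add_smul])

theorem rankOne_smul_left (c : ℂ) (v : H) (w : K) : rankOne (c • v) w = c • rankOne v w :=
  toCLM_injective (ContinuousLinearMap.ext fun _ => smul_comm _ _ _)

theorem rankOne_smul_right (c : ℂ) (v : H) (w : K) :
    rankOne v (c • w) = starRingEnd ℂ c • rankOne v w :=
  toCLM_injective (ContinuousLinearMap.ext fun k => by
    change ⟪c • w, k⟫_ℂ • v = starRingEnd ℂ c • ⟪w, k⟫_ℂ • v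
    rw [inner_smul_left, mul_smul])

/-- A sesquilinear form that vanishes on the diagonal is zero. -/
theorem sesquilinear_eq_zero_of_diag {V : Type*} [AddCommGroup V] [Module ℂ V] {q : V → V → ℂ}
    (hal : ∀ x y z, q (x + y) z = q x z + q y z) (har : ∀ x y z, q x (y + z) = q x y + q x z)
    (hl : ∀ x y, q (Complex.I • x) y = -Complex.I * q x y)
    (hr : ∀ x y, q x (Complex.I • y) = Complex.I * q x y) (h : ∀ x, q x x = 0) (x y : V) :
    q x y = 0 := by
  have h1 := h (x + y)
  have h2 := h (x + Complex.I • y)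
  simp only [hal, har, hl, hr, h, mul_zero, zero_add, add_zero] at h1 h2
  have h3 : q x y - q y x = 0 :=
    (mul_eq_zero.1 (show Complex.I * (q x y - q y x) = 0 by linear_combination h2)).resolve_left
      Complex.I_ne_zero
  linear_combination (h1 + h3) / 2

/-- An operator on `𝔖₂(K, H)` is determined by its quadratic form on rank-one operators. -/
theorem ext_inner_rankOne {P Q : HilbertSchmidt K H →L[ℂ] HilbertSchmidt K H}
    (h : ∀ (v : H) (w : K), ⟪rankOne v w, P (rankOne v w)⟫_ℂ = ⟪rankOne v w, Q (rankOne v w)⟫_ℂ) :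
    P = Q := by
  rw [← sub_eq_zero]
  set D := P - Q with hD
  have h0 : ∀ (v : H) (w : K), ⟪rankOne v w, D (rankOne v w)⟫_ℂ = 0 := fun v w => by
    rw [hD, sub_apply, inner_sub_right, h, sub_self]
  have h1 : ∀ (w : K) (v v' : H), ⟪rankOne v w, D (rankOne v' w)⟫_ℂ = 0 := fun w =>
    sesquilinear_eq_zero_of_diag
      (fun x y z => by rw [rankOne_add_left, inner_add_left])
      (fun x y z => by rw [rankOne_add_left, map_add, inner_add_right])
      (fun x y => by rw [rankOne_smul_left, inner_smul_left, Complex.conj_I])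
      (fun x y => by rw [rankOne_smul_left, map_smul, inner_smul_right])
      (fun v => h0 v w)
  -- `rankOne` is conjugate-linear in its second argument, so the form is conjugate-linear in the
  -- `w'` inside `D` and linear in `w`: the two slots trade places compared with `h1`.
  have h2 : ∀ (v v' : H) (w' w : K), ⟪rankOne v w, D (rankOne v' w')⟫_ℂ = 0 := fun v v' =>
    sesquilinear_eq_zero_of_diag
      (fun x y z => by rw [rankOne_add_right, map_add, inner_add_right])
      (fun x y z => by rw [rankOne_add_right, inner_add_left])
      (fun x y => by rw [rankOne_smul_right, map_smul, inner_smul_right, Complex.conj_I])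
      (fun x y => by rw [rankOne_smul_right, inner_smul_left, Complex.conj_I, map_neg,
        Complex.conj_I, neg_neg])
      (fun w => h1 w v v')
  refine ContinuousLinearMap.ext fun S => eq_zero_of_inner_rankOne fun v w => ?_
  rw [← ContinuousLinearMap.adjoint_inner_left]
  have h3 : ContinuousLinearMap.adjoint D (rankOne v w) = 0 := eq_zero_of_inner_rankOne fun v' w' => by
    rw [ContinuousLinearMap.adjoint_inner_right, ← inner_conj_symm, h2, map_zero]
  rw [h3, inner_zero_left]

/-- The operator `T ↦ A T B`. -/
def sandwich (A : H →L[ℂ] H) (B : K →L[ℂ] K) : HilbertSchmidt K H →L[ℂ] HilbertSchmidt K H :=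
  have hmem : ∀ T : HilbertSchmidt K H, hsEnergy (A ∘L T.toCLM ∘L B) ≤
      ENNReal.ofReal ((‖A‖ * ‖B‖ * ‖T‖) ^ 2) := fun T => by
    rw [mul_pow, mul_pow, ENNReal.ofReal_mul (by positivity), ENNReal.ofReal_mul (by positivity),
      ofReal_norm_sq, mul_assoc]
    exact (hsEnergy_comp_left_le _ _).trans (mul_le_mul_right (hsEnergy_comp_right_le _ _) _)
  LinearMap.mkContinuous
    { toFun := fun T => ((⟨A ∘L T.toCLM ∘L B, (mem_hsSubmodule_iff _).2
        (ne_top_of_le_ne_top ENNReal.ofReal_ne_top (hmem T))⟩ : hsSubmodule K H) :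
          HilbertSchmidt K H)
      map_add' := fun S T => toCLM_injective (ContinuousLinearMap.ext fun k => map_add A _ _)
      map_smul' := fun c T => toCLM_injective (ContinuousLinearMap.ext fun k => map_smul A _ _) }
    (‖A‖ * ‖B‖) fun T => by
      refine (pow_le_pow_iff_left₀ (norm_nonneg _) (by positivity) two_ne_zero).1 ?_
      refine (ENNReal.ofReal_le_ofReal_iff (by positivity)).1 ?_
      rw [ofReal_norm_sq]
      exact hmem T

theorem sandwich_toCLM (A : H →L[ℂ] H) (B : K →L[ℂ] K) (T : HilbertSchmidt K H) :
    (sandwich A B T).toCLM = A ∘L T.toCLM ∘L B := rfl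

theorem sandwich_mul (A A' : H →L[ℂ] H) (B B' : K →L[ℂ] K) :
    sandwich A B * sandwich A' B' = sandwich (A * A') (B' * B) := rfl

theorem sandwich_one : sandwich (1 : H →L[ℂ] H) (1 : K →L[ℂ] K) = 1 := rfl

theorem sandwich_rankOne (A : H →L[ℂ] H) {B : K →L[ℂ] K} (hB : IsStarProjection B) (v : H) (w : K) :
    sandwich A B (rankOne v w) = rankOne (A v) (B w) :=
  toCLM_injective (ContinuousLinearMap.ext fun k => by
    rw [sandwich_toCLM, rankOne_toCLM_apply, hB.inner_apply_left, ← map_smul]; rfl)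

theorem isStarProjection_sandwich {A : H →L[ℂ] H} {B : K →L[ℂ] K} (hA : IsStarProjection A)
    (hB : IsStarProjection B) : IsStarProjection (sandwich A B) := by
  refine ⟨?_, ?_⟩
  · rw [IsIdempotentElem, sandwich_mul, hA.isIdempotentElem.eq, hB.isIdempotentElem.eq]
  · refine ext_inner_rankOne fun v w => ?_
    rw [ContinuousLinearMap.star_eq_adjoint, ContinuousLinearMap.adjoint_inner_right,
      sandwich_rankOne A hB, inner_rankOne_rankOne, inner_rankOne_rankOne, hA.inner_apply_left,
      hB.inner_apply_left]

end HilbertSchmidt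

end HilbertSchmidtOperators

/-! ### Existence and uniqueness of the double projection-valued measure -/

section DoublePVM

variable {X : Type*} [MeasurableSpace X] {Y : Type*} [MeasurableSpace Y]
  {H : Type*} [NormedAddCommGroup H] [InnerProductSpace ℂ H] [CompleteSpace H]
  {K : Type*} [NormedAddCommGroup K] [InnerProductSpace ℂ K] [CompleteSpace K]

open HilbertSchmidt

theorem isStarProjection_rect (E : PVM X H) (F : PVM Y K) (Γ : Set X) (Δ : Set Y) :
    IsStarProjection (sandwich (E Γ) (F Δ)) :=
  isStarProjection_sandwich (E.isStarProjection Γ) (F.isStarProjection Δ)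

theorem rect_mul_rect (E : PVM X H) (F : PVM Y K) {Γ Γ' : Set X} {Δ Δ' : Set Y}
    (hΓ : MeasurableSet Γ) (hΓ' : MeasurableSet Γ') (hΔ : MeasurableSet Δ)
    (hΔ' : MeasurableSet Δ') :
    sandwich (E Γ) (F Δ) * sandwich (E Γ') (F Δ') = sandwich (E (Γ ∩ Γ')) (F (Δ ∩ Δ')) := by
  rw [sandwich_mul, ← E.inter hΓ hΓ', ← F.inter hΔ' hΔ, Set.inter_comm Δ']

/-- This identifies the target of the construction: a rectangle projection has the product measure
as its form on rank-one operators. -/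
theorem inner_rect_rankOne (E : PVM X H) (F : PVM Y K) {Γ : Set X} {Δ : Set Y}
    (hΓ : MeasurableSet Γ) (hΔ : MeasurableSet Δ) (v : H) (w : K) :
    ⟪rankOne v w, sandwich (E Γ) (F Δ) (rankOne v w)⟫_ℂ =
      (((E.diagMeasure v).prod (F.diagMeasure w)).real (Γ ×ˢ Δ) : ℂ) := by
  rw [sandwich_rankOne _ (F.isStarProjection Δ), inner_rankOne_rankOne,
    E.inner_self_eq_real_diagMeasure v hΓ, (F.isStarProjection Δ).inner_apply_left,
    F.inner_self_eq_real_diagMeasure w hΔ, measureReal_prod_prod]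
  push_cast
  ring

/-- Partial sums of the measures of disjoint measurable sets converge to the measure of the
union. -/
theorem tendsto_sum_measureReal_iUnion {Ω : Type*} [MeasurableSpace Ω] (μ : Measure Ω)
    [IsFiniteMeasure μ] {s : ℕ → Set Ω} (hs : ∀ n, MeasurableSet (s n))
    (hd : Pairwise fun m n => Disjoint (s m) (s n)) :
    Filter.Tendsto (fun n => ∑ i ∈ Finset.range n, μ.real (s i)) Filter.atTop
      (nhds (μ.real (⋃ n, s n))) := by
  refine HasSum.tendsto_sum_nat ?_
  have h := measure_iUnion (μ := μ) hd hs
  rw [measureReal_def, h, ENNReal.tsum_toReal_eq fun n => measure_ne_top _ _]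
  exact (ENNReal.summable_toReal (h ▸ measure_ne_top _ _)).hasSum

/-- Auxiliary form of the existence of the double projection-valued measure: the extra
multiplicativity clause makes the induction over the product `σ`-algebra work. -/
theorem exists_projection_mul (E : PVM X H) (F : PVM Y K) (s : Set (X × Y)) (hs : MeasurableSet s) :
    ∃ P : HilbertSchmidt K H →L[ℂ] HilbertSchmidt K H, IsStarProjection P ∧
      (∀ Γ Δ, MeasurableSet Γ → MeasurableSet Δ → Commute P (sandwich (E Γ) (F Δ))) ∧
      ∀ (t : Set (X × Y)) (Q : HilbertSchmidt K H →L[ℂ] HilbertSchmidt K H), MeasurableSet t →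
        (∀ Γ Δ, MeasurableSet Γ → MeasurableSet Δ → Commute Q (sandwich (E Γ) (F Δ))) →
        (∀ v w, ⟪rankOne v w, Q (rankOne v w)⟫_ℂ =
          (((E.diagMeasure v).prod (F.diagMeasure w)).real t : ℂ)) →
        ∀ v w, ⟪rankOne v w, P (Q (rankOne v w))⟫_ℂ =
          (((E.diagMeasure v).prod (F.diagMeasure w)).real (s ∩ t) : ℂ) := by
  induction s, hs using MeasurableSpace.induction_on_inter generateFrom_prod.symm isPiSystem_prod with
  | empty =>
    refine ⟨0, .zero _, fun Γ Δ _ _ => Commute.zero_left _, fun t Q _ _ _ v w => ?_⟩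
    simp
  | basic s hs =>
    obtain ⟨Γ, hΓ, Δ, hΔ, rfl⟩ := hs
    rw [Set.mem_ofPred_eq] at hΓ hΔ
    have hP := isStarProjection_rect E F Γ Δ
    refine ⟨sandwich (E Γ) (F Δ), hP, fun Γ' Δ' hΓ' hΔ' => ?_, fun t Q ht hQ hQt v w => ?_⟩
    · rw [Commute, SemiconjBy, rect_mul_rect E F hΓ hΓ' hΔ hΔ', rect_mul_rect E F hΓ' hΓ hΔ' hΔ,
        Set.inter_comm, Set.inter_comm Δ]
    · have hc : sandwich (E Γ) (F Δ) (Q (rankOne v w)) = Q (sandwich (E Γ) (F Δ) (rankOne v w)) :=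
        congrArg (fun T : HilbertSchmidt K H →L[ℂ] HilbertSchmidt K H => T (rankOne v w))
          (hQ Γ Δ hΓ hΔ).eq.symm
      -- With `P` the rectangle projection, `P Q = P P Q = P Q P`. The form of `P Q` is thus that of
      -- `Q` at the vectors `E Γ v` and `F Δ w`, whose product measure is the restriction to `Γ ×ˢ
      -- Δ`.
      rw [← hP.apply_apply, ← hP.inner_apply_left, hc, sandwich_rankOne _ (F.isStarProjection Δ),
        hQt, E.diagMeasure_apply_vector v hΓ, F.diagMeasure_apply_vector w hΔ, Measure.prod_restrict,
        measureReal_restrict_apply ht, Set.inter_comm]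
  | compl s hs ih =>
    obtain ⟨P, hP, hPc, hPm⟩ := ih
    refine ⟨1 - P, hP.one_sub, fun Γ Δ hΓ hΔ => (Commute.one_left _).sub_left (hPc Γ Δ hΓ hΔ),
      fun t Q ht hQ hQt v w => ?_⟩
    rw [sub_apply, inner_sub_right, hPm t Q ht hQ hQt, one_apply_eq_self, hQt,
      ← Complex.ofReal_sub]
    congr 1
    rw [Set.inter_comm s, Set.inter_comm sᶜ, ← Set.sdiff_eq]
    have := measureReal_inter_add_sdiff (μ := (E.diagMeasure v).prod (F.diagMeasure w)) (s := t) hs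
    linarith
  | iUnion s hd hs ih =>
    choose P hP hPc hPm using ih
    -- The multiplicativity clause with `t = univ` and `Q = 1` recovers the form of `P n` itself.
    have hrep : ∀ n v w, ⟪rankOne v w, P n (rankOne v w)⟫_ℂ =
        (((E.diagMeasure v).prod (F.diagMeasure w)).real (s n) : ℂ) := fun n v w => by
      have := hPm n (.univ) 1 .univ (fun _ _ _ _ => Commute.one_left _) (fun v w => by
        rw [← sandwich_one, ← E.univ', ← F.univ', inner_rect_rankOne E F .univ .univ,
          Set.univ_prod_univ]) v w
      rwa [Set.inter_univ] at this
    -- Here the clause is needed with `Q = P n`, which is not a rectangle projection: `P m * P n`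
    -- represents `s m ∩ s n = ∅`, so its form vanishes.
    have horth : Pairwise fun m n => P m * P n = 0 := fun m n hmn =>
      ext_inner_rankOne fun v w => by
        have := hPm m (s n) (P n) (hs n) (hPc n) (hrep n) v w
        rw [(hd hmn).inter_eq, measureReal_empty, Complex.ofReal_zero] at this
        rw [zero_apply, inner_zero_right]
        exact this
    obtain ⟨Q, hQ, hQlim⟩ := IsStarProjection.exists_tendsto_sum hP horth
    refine ⟨Q, hQ, fun Γ Δ hΓ hΔ => ContinuousLinearMap.ext fun T => ?_,
      fun t R ht hR hRt v w => ?_⟩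
    · refine tendsto_nhds_unique (hQlim (sandwich (E Γ) (F Δ) T)) ?_
      have h1 := ((sandwich (E Γ) (F Δ)).continuous.tendsto _).comp (hQlim T)
      refine h1.congr fun n => ?_
      rw [Function.comp_apply, map_sum]
      exact Finset.sum_congr rfl fun i _ =>
        congrArg (fun T' : HilbertSchmidt K H →L[ℂ] HilbertSchmidt K H => T' T)
          (hPc i Γ Δ hΓ hΔ).eq.symm
    · have h1 := (tendsto_const_nhds (x := rankOne v w)).inner (𝕜 := ℂ) (hQlim (R (rankOne v w)))
      have h2 := tendsto_sum_measureReal_iUnion ((E.diagMeasure v).prod (F.diagMeasure w))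
        (fun n => (hs n).inter ht)
        (fun m n hmn => (hd hmn).mono Set.inter_subset_left Set.inter_subset_left)
      refine tendsto_nhds_unique h1 ?_
      rw [Set.iUnion_inter]
      refine ((Complex.continuous_ofReal.tendsto _).comp h2).congr fun n => ?_
      rw [Function.comp_apply, inner_sum, Complex.ofReal_sum]
      exact Finset.sum_congr rfl fun i _ => (hPm i t R ht hR hRt v w).symm

theorem exists_projection (E : PVM X H) (F : PVM Y K) {s : Set (X × Y)} (hs : MeasurableSet s) :
    ∃ P : HilbertSchmidt K H →L[ℂ] HilbertSchmidt K H, IsStarProjection P ∧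
      ∀ v w, ⟪rankOne v w, P (rankOne v w)⟫_ℂ =
        (((E.diagMeasure v).prod (F.diagMeasure w)).real s : ℂ) := by
  obtain ⟨P, hP, -, hPm⟩ := exists_projection_mul E F s hs
  refine ⟨P, hP, fun v w => ?_⟩
  have := hPm (.univ) 1 .univ (fun _ _ _ _ => Commute.one_left _) (fun v w => by
    rw [← sandwich_one, ← E.univ', ← F.univ', inner_rect_rankOne E F .univ .univ,
      Set.univ_prod_univ]) v w
  rwa [Set.inter_univ] at this

open Classical in
/-- The projection attached to a subset of `X × Y` by the double projection-valued measure. -/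
def doubleProjection (E : PVM X H) (F : PVM Y K) (s : Set (X × Y)) :
    HilbertSchmidt K H →L[ℂ] HilbertSchmidt K H :=
  if hs : MeasurableSet s then (exists_projection E F hs).choose else 0

theorem isStarProjection_doubleProjection (E : PVM X H) (F : PVM Y K) {s : Set (X × Y)}
    (hs : MeasurableSet s) : IsStarProjection (doubleProjection E F s) := by
  rw [doubleProjection, dif_pos hs]
  exact (exists_projection E F hs).choose_spec.1

theorem inner_doubleProjection (E : PVM X H) (F : PVM Y K) {s : Set (X × Y)}
    (hs : MeasurableSet s) (v : H) (w : K) :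
    ⟪rankOne v w, doubleProjection E F s (rankOne v w)⟫_ℂ =
      (((E.diagMeasure v).prod (F.diagMeasure w)).real s : ℂ) := by
  rw [doubleProjection, dif_pos hs]
  exact (exists_projection E F hs).choose_spec.2 v w

theorem doubleProjection_rect (E : PVM X H) (F : PVM Y K) {Γ : Set X} {Δ : Set Y}
    (hΓ : MeasurableSet Γ) (hΔ : MeasurableSet Δ) :
    doubleProjection E F (Γ ×ˢ Δ) = sandwich (E Γ) (F Δ) :=
  ext_inner_rankOne fun v w => by
    rw [inner_doubleProjection E F (hΓ.prod hΔ), inner_rect_rankOne E F hΓ hΔ]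

theorem doubleProjection_mul_of_disjoint (E : PVM X H) (F : PVM Y K) {s t : Set (X × Y)}
    (hs : MeasurableSet s) (ht : MeasurableSet t) (hd : Disjoint s t) :
    doubleProjection E F s * doubleProjection E F t = 0 := by
  refine (isStarProjection_doubleProjection E F hs).mul_eq_zero_of_add
    (isStarProjection_doubleProjection E F ht) ?_
  have h : doubleProjection E F s + doubleProjection E F t = doubleProjection E F (s ∪ t) :=
    ext_inner_rankOne fun v w => by
      rw [add_apply, inner_add_right, inner_doubleProjection E F hs, inner_doubleProjection E F ht,
        inner_doubleProjection E F (hs.union ht), measureReal_union hd ht, Complex.ofReal_add]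
  rw [h]
  exact isStarProjection_doubleProjection E F (hs.union ht)

/-- The double projection-valued measure. -/
def doublePVM (E : PVM X H) (F : PVM Y K) : PVM (X × Y) (HilbertSchmidt K H) where
  toFun := doubleProjection E F
  isStarProjection' _ hs := isStarProjection_doubleProjection E F hs
  univ' := by
    rw [← Set.univ_prod_univ, doubleProjection_rect E F .univ .univ, E.univ', F.univ', sandwich_one]
  iUnion' s hs hd := by
    have hP := fun n => isStarProjection_doubleProjection E F (hs n)
    obtain ⟨Q, hQ, hQlim⟩ := IsStarProjection.exists_tendsto_sum hP fun m n hmn =>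
      doubleProjection_mul_of_disjoint E F (hs m) (hs n) (hd hmn)
    -- The projection of the union was chosen independently of the strong limit `Q`; the two agree
    -- because their forms on rank-one operators do.
    have hQeq : doubleProjection E F (⋃ n, s n) = Q := ext_inner_rankOne fun v w => by
      rw [inner_doubleProjection E F (.iUnion hs)]
      refine (tendsto_nhds_unique ((tendsto_const_nhds (x := rankOne v w)).inner (𝕜 := ℂ)
        (hQlim (rankOne v w))) ?_).symm
      refine ((Complex.continuous_ofReal.tendsto _).comp (tendsto_sum_measureReal_iUnion
        ((E.diagMeasure v).prod (F.diagMeasure w)) hs hd)).congr fun n => ?_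
      rw [Function.comp_apply, inner_sum, Complex.ofReal_sum]
      exact Finset.sum_congr rfl fun i _ => (inner_doubleProjection E F (hs i) v w).symm
    rw [hQeq]
    exact IsStarProjection.hasSum_inner_of_tendsto hP hQ hQlim
  not_measurable' s hs := dif_neg hs

theorem isDoublePVM_doublePVM (E : PVM X H) (F : PVM Y K) : IsDoublePVM E F (doublePVM E F) :=
  fun Γ Δ hΓ hΔ T => by
    change (doubleProjection E F (Γ ×ˢ Δ) T).toCLM = _
    rw [doubleProjection_rect E F hΓ hΔ, sandwich_toCLM]

namespace IsDoublePVM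

variable {E : PVM X H} {F : PVM Y K} {G : PVM (X × Y) (HilbertSchmidt K H)}

theorem diagMeasure_rankOne (hG : IsDoublePVM E F G) (v : H) (w : K) :
    G.diagMeasure (rankOne v w) = (E.diagMeasure v).prod (F.diagMeasure w) := by
  refine (Measure.prod_eq fun Γ Δ hΓ hΔ => ?_).symm
  have h : G (Γ ×ˢ Δ) = sandwich (E Γ) (F Δ) :=
    ContinuousLinearMap.ext fun T => toCLM_injective (hG Γ Δ hΓ hΔ T)
  rw [G.diagMeasure_apply _ (hΓ.prod hΔ), h, inner_rect_rankOne E F hΓ hΔ, Complex.ofReal_re,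
    ofReal_measureReal, Measure.prod_prod]

theorem inner_rankOne (hG : IsDoublePVM E F G) {s : Set (X × Y)} (hs : MeasurableSet s) (v : H)
    (w : K) : ⟪rankOne v w, G s (rankOne v w)⟫_ℂ =
      (((E.diagMeasure v).prod (F.diagMeasure w)).real s : ℂ) := by
  rw [G.inner_self_eq_real_diagMeasure _ hs, hG.diagMeasure_rankOne]

theorem unique {G' : PVM (X × Y) (HilbertSchmidt K H)} (hG : IsDoublePVM E F G)
    (hG' : IsDoublePVM E F G') : G' = G :=
  PVM.ext_of_measurable fun _ hs => ext_inner_rankOne fun v w => by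
    rw [hG.inner_rankOne hs, hG'.inner_rankOne hs]

/-- Rank-one operators suffice to test nullity, although `G.diagMeasure T` is defined for every
Hilbert–Schmidt `T`. -/
theorem eq_zero_iff (hG : IsDoublePVM E F G) {s : Set (X × Y)} (hs : MeasurableSet s) :
    G s = 0 ↔ ∀ v w, (E.diagMeasure v).prod (F.diagMeasure w) s = 0 := by
  constructor
  · intro h v w
    rw [← hG.diagMeasure_rankOne]
    exact (G.eq_zero_iff hs).1 h _
  · intro h
    refine ext_inner_rankOne fun v w => ?_
    rw [hG.inner_rankOne hs, measureReal_def, h]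
    simp

/-- A measurable property holds `G`-almost everywhere if it holds almost everywhere for all the
product measures. -/
theorem ae_iff (hG : IsDoublePVM E F G) {p : X × Y → Prop} (hp : MeasurableSet {x | p x}) :
    G.AE p ↔ ∀ v w, ∀ᵐ x ∂(E.diagMeasure v).prod (F.diagMeasure w), p x := by
  constructor
  · rintro ⟨N, hN, hN0, hNp⟩ v w
    refine measure_mono_null (fun x hx => ?_) ((hG.eq_zero_iff hN).1 hN0 v w)
    by_contra h
    exact hx (hNp x h)
  · exact fun h => ⟨{x | p x}ᶜ, hp.compl, (hG.eq_zero_iff hp.compl).2 h, fun x hx =>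
      not_not.1 hx⟩

end IsDoublePVM

end DoublePVM

/-! ### Measurability on countable disjoint unions and of fibrewise essential suprema -/

section Measurability

theorem measurableEmbedding_sigmaMk {ι : Type*} {Z : ι → Type*} [∀ i, MeasurableSpace (Z i)]
    (i : ι) : MeasurableEmbedding (Sigma.mk i : Z i → Σ i, Z i) where
  injective := sigma_mk_injective
  measurable := Measurable.of_le_map (iInf_le _ i)
  measurableSet_image' := fun s hs => by
    rw [MeasurableSpace.measurableSet_iInf]
    intro j
    rw [MeasurableSpace.map_def]
    by_cases h : i = j
    · subst h
      rwa [Set.preimage_image_eq _ sigma_mk_injective]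
    · convert! MeasurableSet.empty
      ext z
      simp only [Set.mem_preimage, Set.mem_image, Sigma.mk.injEq, Set.mem_empty_iff_false, iff_false]
      rintro ⟨_, _, h', _⟩
      exact h h'

theorem measurable_prod_sigma {X ι W : Type*} [MeasurableSpace X] [MeasurableSpace W] [Countable ι]
    {Z : ι → Type*} [∀ i, MeasurableSpace (Z i)] {f : X × (Σ i, Z i) → W}
    (hf : ∀ i, Measurable fun p : X × Z i => f (p.1, ⟨i, p.2⟩)) : Measurable f := by
  intro s hs
  have h : f ⁻¹' s = ⋃ i, Prod.map id (Sigma.mk i) '' ((fun p : X × Z i => f (p.1, ⟨i, p.2⟩)) ⁻¹' s) := by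
    ext ⟨x, i, z⟩
    simp only [Set.mem_preimage, Set.mem_iUnion, Set.mem_image, Prod.exists, Prod.map_apply, id]
    constructor
    · exact fun h => ⟨i, x, z, h, rfl⟩
    · rintro ⟨j, x', z', h, he⟩
      rwa [← he]
  rw [h]
  exact MeasurableSet.iUnion fun i => (MeasurableEmbedding.id.prodMap
    (measurableEmbedding_sigmaMk i)).measurableSet_image.2 (hf i hs)

/-- The essential supremum of a slice is at most `c` exactly when the slice of `{c < ‖f‖}` is null,
and slice measures are measurable in `z`. -/
theorem measurable_eLpNorm_top_slice {X Z : Type*} [MeasurableSpace X] [MeasurableSpace Z]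
    (μ : Measure X) [SFinite μ] {f : X × Z → ℂ} (hf : Measurable f) :
    Measurable fun z => eLpNorm (fun x => f (x, z)) ∞ μ := by
  refine measurable_of_Iic fun c => ?_
  have h : (fun z => eLpNorm (fun x => f (x, z)) ∞ μ) ⁻¹' Set.Iic c =
      {z | μ ((fun x => (x, z)) ⁻¹' {p | c < ‖f p‖ₑ}) = 0} := by
    ext z
    rw [Set.mem_preimage, Set.mem_Iic, eLpNorm_exponent_top]
    have h1 : eLpNormEssSup (fun x => f (x, z)) μ ≤ c ↔ ∀ᵐ x ∂μ, ‖f (x, z)‖ₑ ≤ c :=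
      ⟨fun h => (ae_le_eLpNormEssSup (f := fun x => f (x, z))).mono fun x hx => hx.trans h,
        fun h => essSup_le_of_ae_le _ h⟩
    rw [h1, ae_iff]
    simp only [not_le]
    rfl
  rw [h]
  exact (measurable_measure_prodMk_right (measurableSet_lt measurable_const hf.enorm))
    (measurableSet_singleton 0)

end Measurability

/-! ### Operations on integral decompositions -/

namespace IntegralData

variable {X : Type uX} [MeasurableSpace X] {Y : Type uY} [MeasurableSpace Y]
  {H : Type*} [NormedAddCommGroup H] [InnerProductSpace ℂ H] [CompleteSpace H]
  {K : Type*} [NormedAddCommGroup K] [InnerProductSpace ℂ K] [CompleteSpace K]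

theorem integrable (D : IntegralData.{uX, uY, uZ} X Y) (x : X) (y : Y) :
    Integrable (fun z => D.α (x, z) * D.β (y, z)) D.ν := by
  obtain ⟨hα, C, hC⟩ := D.α_mem
  obtain ⟨hβ, C', hC'⟩ := D.β_mem
  refine Integrable.of_bound (C := C * C') ?_ (.of_forall fun z => ?_)
  · exact ((hα.comp measurable_prodMk_left).mul (hβ.comp measurable_prodMk_left)).aestronglyMeasurable
  · rw [norm_mul]
    exact mul_le_mul (hC _) (hC' _) (norm_nonneg _) ((norm_nonneg _).trans (hC (x, z)))

theorem value_mem (D : IntegralData.{uX, uY, uZ} X Y) : D.value ∈ BddMeas (X × Y) := by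
  obtain ⟨hα, C, hC⟩ := D.α_mem
  obtain ⟨hβ, C', hC'⟩ := D.β_mem
  refine ⟨?_, C * C' * D.ν.real Set.univ, fun p => ?_⟩
  · have h : Measurable fun q : (X × Y) × D.Z => D.α (q.1.1, q.2) * D.β (q.1.2, q.2) :=
      (hα.comp (by fun_prop)).mul (hβ.comp (by fun_prop))
    exact h.stronglyMeasurable.integral_prod_right.measurable
  · refine norm_integral_le_of_norm_le_const (.of_forall fun z => ?_)
    rw [norm_mul]
    exact mul_le_mul (hC _) (hC' _) (norm_nonneg _) ((norm_nonneg _).trans (hC (p.1, z)))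

/-- The double integral in the cost, for a single pair of vectors. -/
def costAt (D : IntegralData.{uX, uY, uZ} X Y) (E : PVM X H) (F : PVM Y K) (v : H) (w : K) : ℝ≥0∞ :=
  ∫⁻ z, eLpNorm (fun x => D.α (x, z)) ∞ (E.diagMeasure v) *
    eLpNorm (fun y => D.β (y, z)) ∞ (F.diagMeasure w) ∂D.ν

theorem costAt_le_cost (D : IntegralData.{uX, uY, uZ} X Y) (E : PVM X H) (F : PVM Y K) (v : H)
    (w : K) : D.costAt E F v w ≤ D.cost E F :=
  le_iSup₂ (f := fun v w => D.costAt E F v w) v w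

theorem cost_le {D : IntegralData.{uX, uY, uZ} X Y} {E : PVM X H} {F : PVM Y K} {c : ℝ≥0∞}
    (h : ∀ v w, D.costAt E F v w ≤ c) : D.cost E F ≤ c := iSup₂_le h

theorem measurable_alphaNorm (D : IntegralData.{uX, uY, uZ} X Y) (E : PVM X H) (v : H) :
    Measurable fun z => eLpNorm (fun x => D.α (x, z)) ∞ (E.diagMeasure v) :=
  measurable_eLpNorm_top_slice _ D.α_mem.1

theorem measurable_betaNorm (D : IntegralData.{uX, uY, uZ} X Y) (F : PVM Y K) (w : K) :
    Measurable fun z => eLpNorm (fun y => D.β (y, z)) ∞ (F.diagMeasure w) :=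
  measurable_eLpNorm_top_slice _ D.β_mem.1

theorem eLpNorm_top_le_of_bound {Ω : Type*} [MeasurableSpace Ω] {μ : Measure Ω} {f : Ω → ℂ} {C : ℝ}
    (h : ∀ x, ‖f x‖ ≤ C) : eLpNorm f ∞ μ ≤ ENNReal.ofReal C := by
  rw [eLpNorm_exponent_top]
  refine essSup_le_of_ae_le _ (.of_forall fun x => ?_)
  change ‖f x‖ₑ ≤ ENNReal.ofReal C
  rw [← ofReal_norm]
  exact ENNReal.ofReal_le_ofReal (h x)

theorem cost_le_of_bound (D : IntegralData.{uX, uY, uZ} X Y) (E : PVM X H) (F : PVM Y K) {C C' : ℝ}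
    (hC : ∀ p, ‖D.α p‖ ≤ C) (hC' : ∀ p, ‖D.β p‖ ≤ C') :
    D.cost E F ≤ ENNReal.ofReal C * ENNReal.ofReal C' * D.ν Set.univ :=
  cost_le fun v w => by
    rw [← lintegral_const]
    exact lintegral_mono fun z => mul_le_mul' (eLpNorm_top_le_of_bound fun x => hC _)
      (eLpNorm_top_le_of_bound fun y => hC' _)

theorem cost_ne_top (D : IntegralData.{uX, uY, uZ} X Y) (E : PVM X H) (F : PVM Y K) :
    D.cost E F ≠ ∞ := by
  obtain ⟨-, C, hC⟩ := D.α_mem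
  obtain ⟨-, C', hC'⟩ := D.β_mem
  exact ne_top_of_le_ne_top (ENNReal.mul_ne_top (ENNReal.mul_ne_top ENNReal.ofReal_ne_top
    ENNReal.ofReal_ne_top) (measure_ne_top _ _)) (D.cost_le_of_bound E F hC hC')

/-- The decomposition of the constant function `1` over a one-point space. -/
def one (X : Type uX) [MeasurableSpace X] (Y : Type uY) [MeasurableSpace Y] :
    IntegralData.{uX, uY, uZ} X Y where
  Z := PUnit
  ν := Measure.dirac PUnit.unit
  α := 1
  β := 1
  α_mem := one_mem _
  β_mem := one_mem _

theorem one_value : (one.{uX, uY, uZ} X Y).value = 1 := by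
  ext p
  change ∫ _ : PUnit, (1 : ℂ) * 1 ∂Measure.dirac PUnit.unit = 1
  simp

theorem one_cost_le (E : PVM X H) (F : PVM Y K) : (one.{uX, uY, uZ} X Y).cost E F ≤ 1 := by
  refine ((one X Y).cost_le_of_bound E F (C := 1) (C' := 1) (fun p => ?_) fun p => ?_).trans ?_
  · change ‖(1 : ℂ)‖ ≤ 1; simp
  · change ‖(1 : ℂ)‖ ≤ 1; simp
  · change _ * Measure.dirac PUnit.unit Set.univ ≤ _; simp

/-- Multiplication by a scalar. -/
def smul (c : ℂ) (D : IntegralData.{uX, uY, uZ} X Y) : IntegralData.{uX, uY, uZ} X Y where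
  Z := D.Z
  ν := D.ν
  α := c • D.α
  β := D.β
  α_mem := (BddMeas _).smul_mem D.α_mem c
  β_mem := D.β_mem

theorem smul_value (c : ℂ) (D : IntegralData.{uX, uY, uZ} X Y) : (D.smul c).value = c • D.value := by
  ext p
  simp only [value, smul, Pi.smul_apply, smul_eq_mul, mul_assoc]
  exact integral_const_mul _ _

theorem smul_cost_le (c : ℂ) (D : IntegralData.{uX, uY, uZ} X Y) (E : PVM X H) (F : PVM Y K) :
    (D.smul c).cost E F ≤ ‖c‖ₑ * D.cost E F :=
  cost_le fun v w => by
    refine le_trans (le_of_eq ?_) (mul_le_mul_right (D.costAt_le_cost E F v w) _)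
    have h : ∀ z : D.Z, eLpNorm (fun x => (c • D.α) (x, z)) ∞ (E.diagMeasure v) =
        ‖c‖ₑ * eLpNorm (fun x => D.α (x, z)) ∞ (E.diagMeasure v) := fun z =>
      eLpNorm_const_smul c (fun x => D.α (x, z)) ∞ _
    change ∫⁻ z : D.Z, eLpNorm (fun x => (c • D.α) (x, z)) ∞ (E.diagMeasure v) * _ ∂D.ν = _
    simp only [h, mul_assoc]
    exact lintegral_const_mul _ ((D.measurable_alphaNorm E v).mul (D.measurable_betaNorm F w))

/-- Complex conjugation. -/
def conj (D : IntegralData.{uX, uY, uZ} X Y) : IntegralData.{uX, uY, uZ} X Y where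
  Z := D.Z
  ν := D.ν
  α := star D.α
  β := star D.β
  α_mem := star_mem D.α_mem
  β_mem := star_mem D.β_mem

theorem conj_value (D : IntegralData.{uX, uY, uZ} X Y) : D.conj.value = star D.value := by
  ext p
  simp only [value, Pi.star_apply]
  rw [← starRingEnd_apply, ← integral_conj]
  refine integral_congr_ae (.of_forall fun z => ?_)
  exact (map_mul (starRingEnd ℂ) _ _).symm

theorem eLpNorm_top_star {Ω : Type*} [MeasurableSpace Ω] (μ : Measure Ω) (f : Ω → ℂ) :
    eLpNorm (fun x => star (f x)) ∞ μ = eLpNorm f ∞ μ :=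
  eLpNorm_congr_norm_ae (.of_forall fun _ => norm_star _)

theorem conj_cost (D : IntegralData.{uX, uY, uZ} X Y) (E : PVM X H) (F : PVM Y K) :
    D.conj.cost E F = D.cost E F := by
  unfold cost
  refine iSup_congr fun v => iSup_congr fun w => lintegral_congr fun z => ?_
  exact congrArg₂ _ (eLpNorm_top_star _ fun x => D.α (x, z)) (eLpNorm_top_star _ fun y => D.β (y, z))

/-- The product decomposition, over the product space. -/
def mul (D D' : IntegralData.{uX, uY, uZ} X Y) : IntegralData.{uX, uY, uZ} X Y where
  Z := D.Z × D'.Z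
  ν := D.ν.prod D'.ν
  α := fun p => D.α (p.1, p.2.1) * D'.α (p.1, p.2.2)
  β := fun p => D.β (p.1, p.2.1) * D'.β (p.1, p.2.2)
  α_mem := by
    obtain ⟨hα, C, hC⟩ := D.α_mem
    obtain ⟨hα', C', hC'⟩ := D'.α_mem
    refine ⟨(hα.comp (by fun_prop)).mul (hα'.comp (by fun_prop)), C * C', fun p => ?_⟩
    rw [norm_mul]
    exact mul_le_mul (hC _) (hC' _) (norm_nonneg _) ((norm_nonneg _).trans (hC (p.1, p.2.1)))
  β_mem := by
    obtain ⟨hα, C, hC⟩ := D.β_mem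
    obtain ⟨hα', C', hC'⟩ := D'.β_mem
    refine ⟨(hα.comp (by fun_prop)).mul (hα'.comp (by fun_prop)), C * C', fun p => ?_⟩
    rw [norm_mul]
    exact mul_le_mul (hC _) (hC' _) (norm_nonneg _) ((norm_nonneg _).trans (hC (p.1, p.2.1)))

theorem mul_value (D D' : IntegralData.{uX, uY, uZ} X Y) :
    (D.mul D').value = D.value * D'.value := by
  ext p
  rw [Pi.mul_apply, value, value, value, ← integral_prod_mul]
  refine integral_congr_ae (.of_forall fun z => ?_)
  simp only [mul]
  ring

theorem eLpNorm_top_mul_le {Ω : Type*} [MeasurableSpace Ω] {μ : Measure Ω} {f g : Ω → ℂ}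
    (hf : Measurable f) (hg : Measurable g) :
    eLpNorm (fun x => f x * g x) ∞ μ ≤ eLpNorm f ∞ μ * eLpNorm g ∞ μ :=
  eLpNorm_smul_le_mul_eLpNorm (φ := f) hg.aestronglyMeasurable hf.aestronglyMeasurable

theorem mul_cost_le (D D' : IntegralData.{uX, uY, uZ} X Y) (E : PVM X H) (F : PVM Y K) :
    (D.mul D').cost E F ≤ D.cost E F * D'.cost E F :=
  cost_le fun v w => by
    refine le_trans ?_ (mul_le_mul' (D.costAt_le_cost E F v w) (D'.costAt_le_cost E F v w))
    have h := lintegral_prod_mul (μ := D.ν) (ν := D'.ν)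
      (f := fun z => eLpNorm (fun x => D.α (x, z)) ∞ (E.diagMeasure v) *
        eLpNorm (fun y => D.β (y, z)) ∞ (F.diagMeasure w))
      (g := fun z => eLpNorm (fun x => D'.α (x, z)) ∞ (E.diagMeasure v) *
        eLpNorm (fun y => D'.β (y, z)) ∞ (F.diagMeasure w))
      ((D.measurable_alphaNorm E v).mul (D.measurable_betaNorm F w)).aemeasurable
      ((D'.measurable_alphaNorm E v).mul (D'.measurable_betaNorm F w)).aemeasurable
    refine le_trans ?_ h.le
    refine lintegral_mono (μ := D.ν.prod D'.ν) fun z : D.Z × D'.Z => ?_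
    rw [mul_mul_mul_comm]
    have h1 : Measurable fun x => D.α (x, z.1) := D.α_mem.1.comp measurable_prodMk_right
    have h2 : Measurable fun x => D'.α (x, z.2) := D'.α_mem.1.comp measurable_prodMk_right
    have h3 : Measurable fun y => D.β (y, z.1) := D.β_mem.1.comp measurable_prodMk_right
    have h4 : Measurable fun y => D'.β (y, z.2) := D'.β_mem.1.comp measurable_prodMk_right
    exact mul_le_mul' (eLpNorm_top_mul_le h1 h2) (eLpNorm_top_mul_le h3 h4)

/-- The sum of countably many decompositions with uniformly bounded functions and summable
total masses, over the disjoint union of the spaces. -/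
def sigma {ι : Type} [Countable ι] (D : ι → IntegralData.{uX, uY, uZ} X Y)
    (hα : ∃ C : ℝ, ∀ i p, ‖(D i).α p‖ ≤ C) (hβ : ∃ C : ℝ, ∀ i p, ‖(D i).β p‖ ≤ C)
    (hν : ∑' i, (D i).ν Set.univ ≠ ∞) : IntegralData.{uX, uY, uZ} X Y where
  Z := Σ i, (D i).Z
  ν := Measure.sum fun i => (D i).ν.map (Sigma.mk i)
  isFiniteMeasure := ⟨by
    rw [Measure.sum_apply _ .univ]
    simp only [Measure.map_apply (measurableEmbedding_sigmaMk _).measurable .univ,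
      Set.preimage_univ]
    exact hν.lt_top⟩
  α := fun p => (D p.2.1).α (p.1, p.2.2)
  β := fun p => (D p.2.1).β (p.1, p.2.2)
  α_mem := ⟨measurable_prod_sigma fun i => (D i).α_mem.1, hα.imp fun _ hC _ => hC _ _⟩
  β_mem := ⟨measurable_prod_sigma fun i => (D i).β_mem.1, hβ.imp fun _ hC _ => hC _ _⟩

section Sigma

variable {ι : Type} [Countable ι] (D : ι → IntegralData.{uX, uY, uZ} X Y)
    (hα : ∃ C : ℝ, ∀ i p, ‖(D i).α p‖ ≤ C) (hβ : ∃ C : ℝ, ∀ i p, ‖(D i).β p‖ ≤ C)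
    (hν : ∑' i, (D i).ν Set.univ ≠ ∞)

theorem hasSum_sigma_value (p : X × Y) :
    HasSum (fun i => (D i).value p) ((sigma D hα hβ hν).value p) := by
  have h := hasSum_integral_measure ((sigma D hα hβ hν).integrable p.1 p.2)
  have h' := fun i => (measurableEmbedding_sigmaMk (Z := fun i => (D i).Z) i).integral_map
    (μ := (D i).ν) fun z => (sigma D hα hβ hν).α (p.1, z) * (sigma D hα hβ hν).β (p.2, z)
  exact (funext h' : _ = _) ▸ h

theorem sigma_cost_le (E : PVM X H) (F : PVM Y K) :
    (sigma D hα hβ hν).cost E F ≤ ∑' i, (D i).cost E F :=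
  cost_le fun v w => by
    refine le_trans (le_of_eq ?_) (ENNReal.tsum_le_tsum fun i => (D i).costAt_le_cost E F v w)
    refine (lintegral_sum_measure _ _).trans (tsum_congr fun i => ?_)
    exact (measurableEmbedding_sigmaMk i).lintegral_map _

end Sigma

/-- The sum of two decompositions. -/
def add (D D' : IntegralData.{uX, uY, uZ} X Y) : IntegralData.{uX, uY, uZ} X Y :=
  sigma (fun b : Bool => bif b then D else D')
    (by
      obtain ⟨-, C, hC⟩ := D.α_mem
      obtain ⟨-, C', hC'⟩ := D'.α_mem
      refine ⟨max C C', ?_⟩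
      rintro (_ | _) p
      · exact (hC' p).trans (le_max_right _ _)
      · exact (hC p).trans (le_max_left _ _))
    (by
      obtain ⟨-, C, hC⟩ := D.β_mem
      obtain ⟨-, C', hC'⟩ := D'.β_mem
      refine ⟨max C C', ?_⟩
      rintro (_ | _) p
      · exact (hC' p).trans (le_max_right _ _)
      · exact (hC p).trans (le_max_left _ _))
    (by
      rw [tsum_fintype]
      exact ENNReal.sum_ne_top.2 fun b _ => measure_ne_top _ _)

theorem add_value (D D' : IntegralData.{uX, uY, uZ} X Y) :
    (D.add D').value = D.value + D'.value := by
  ext p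
  refine (hasSum_sigma_value (fun b : Bool => bif b then D else D') _ _ _ p).tsum_eq.symm.trans ?_
  rw [tsum_fintype, Fintype.sum_bool]
  rfl

theorem add_cost_le (D D' : IntegralData.{uX, uY, uZ} X Y) (E : PVM X H) (F : PVM Y K) :
    (D.add D').cost E F ≤ D.cost E F + D'.cost E F := by
  refine (sigma_cost_le (fun b : Bool => bif b then D else D') _ _ _ E F).trans_eq ?_
  rw [tsum_fintype, Fintype.sum_bool]
  rfl

end IntegralData

/-! ### The essential bound and normalised decompositions -/

namespace IntegralData

variable {X : Type uX} [MeasurableSpace X] {Y : Type uY} [MeasurableSpace Y]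
  {H : Type*} [NormedAddCommGroup H] [InnerProductSpace ℂ H] [CompleteSpace H]
  {K : Type*} [NormedAddCommGroup K] [InnerProductSpace ℂ K] [CompleteSpace K]

/-- For each fixed `z` the bound holds for a.e. `x` by definition; Fubini for null sets exchanges
the quantifiers, using that the right side is measurable in `z`. -/
theorem ae_ae_enorm_le_eLpNorm_top {X Z : Type*} [MeasurableSpace X] [MeasurableSpace Z]
    (μ : Measure X) [SFinite μ] (ν : Measure Z) [SFinite ν] {f : X × Z → ℂ} (hf : Measurable f) :
    ∀ᵐ x ∂μ, ∀ᵐ z ∂ν, ‖f (x, z)‖ₑ ≤ eLpNorm (fun x => f (x, z)) ∞ μ := by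
  refine (Measure.ae_ae_comm ?_).2 (.of_forall fun z => ?_)
  · exact measurableSet_le hf.enorm ((measurable_eLpNorm_top_slice μ hf).comp measurable_snd)
  · rw [eLpNorm_exponent_top]
    exact ae_le_eLpNormEssSup

theorem ae_ae_enorm_le (D : IntegralData.{uX, uY, uZ} X Y) (E : PVM X H) (F : PVM Y K) (v : H)
    (w : K) : ∀ᵐ p ∂(E.diagMeasure v).prod (F.diagMeasure w), ∀ᵐ z ∂D.ν,
      ‖D.α (p.1, z)‖ₑ ≤ eLpNorm (fun x => D.α (x, z)) ∞ (E.diagMeasure v) ∧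
      ‖D.β (p.2, z)‖ₑ ≤ eLpNorm (fun y => D.β (y, z)) ∞ (F.diagMeasure w) := by
  have h1 := Measure.quasiMeasurePreserving_fst (μ := E.diagMeasure v) (ν := F.diagMeasure w) |>.ae
    (ae_ae_enorm_le_eLpNorm_top (E.diagMeasure v) D.ν D.α_mem.1)
  have h2 := Measure.quasiMeasurePreserving_snd (μ := E.diagMeasure v) (ν := F.diagMeasure w) |>.ae
    (ae_ae_enorm_le_eLpNorm_top (F.diagMeasure w) D.ν D.β_mem.1)
  filter_upwards [h1, h2] with p hp1 hp2
  exact hp1.and hp2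

theorem ae_enorm_value_le (D : IntegralData.{uX, uY, uZ} X Y) (E : PVM X H) (F : PVM Y K) (v : H)
    (w : K) : ∀ᵐ p ∂(E.diagMeasure v).prod (F.diagMeasure w), ‖D.value p‖ₑ ≤ D.cost E F := by
  filter_upwards [D.ae_ae_enorm_le E F v w] with p hp
  refine (enorm_integral_le_lintegral_enorm _).trans (le_trans ?_ (D.costAt_le_cost E F v w))
  refine lintegral_mono_ae (hp.mono fun z hz => ?_)
  rw [enorm_mul]
  exact mul_le_mul' hz.1 hz.2

theorem ae_norm_value_le (D : IntegralData.{uX, uY, uZ} X Y) {E : PVM X H} {F : PVM Y K}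
    {G : PVM (X × Y) (HilbertSchmidt K H)} (hG : IsDoublePVM E F G) :
    G.AE fun p => ‖D.value p‖ ≤ (D.cost E F).toReal := by
  refine (hG.ae_iff (measurableSet_le D.value_mem.1.norm measurable_const)).2 fun v w => ?_
  filter_upwards [D.ae_enorm_value_le E F v w] with p hp
  rw [← toReal_enorm]
  exact ENNReal.toReal_mono (D.cost_ne_top E F) hp

/-- The essential supremum depends on a measure only through its null sets. -/
theorem costAt_mono (D : IntegralData.{uX, uY, uZ} X Y) {E : PVM X H} {F : PVM Y K} {v v' : H}
    {w w' : K} (hv : E.diagMeasure v ≪ E.diagMeasure v') (hw : F.diagMeasure w ≪ F.diagMeasure w') :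
    D.costAt E F v w ≤ D.costAt E F v' w' := by
  refine lintegral_mono fun z => ?_
  simp only [eLpNorm_exponent_top]
  exact mul_le_mul' (eLpNormEssSup_mono_measure _ hv) (eLpNormEssSup_mono_measure _ hw)

/-- The supremum in the cost is attained. -/
theorem exists_costAt_eq_cost (D : IntegralData.{uX, uY, uZ} X Y) (E : PVM X H) (F : PVM Y K) :
    ∃ v w, D.costAt E F v w = D.cost E F := by
  have hcost : D.cost E F = sSup (Set.range fun p : H × K => D.costAt E F p.1 p.2) := by
    rw [sSup_range, iSup_prod]
    rfl
  -- Take a maximising sequence of pairs, then a single pair dominating all of them.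
  obtain ⟨u, -, hu, hmem⟩ := exists_seq_tendsto_sSup
    (Set.range_nonempty fun p : H × K => D.costAt E F p.1 p.2) (OrderTop.bddAbove _)
  choose p hp using hmem
  obtain ⟨v, hv⟩ := E.exists_absolutelyContinuous fun n => (p n).1
  obtain ⟨w, hw⟩ := F.exists_absolutelyContinuous fun n => (p n).2
  refine ⟨v, w, le_antisymm (D.costAt_le_cost E F v w) ?_⟩
  rw [hcost]
  exact le_of_tendsto' hu fun n => (hp n).symm.trans_le (D.costAt_mono (hv n) (hw n))

theorem alphaNorm_ne_top (D : IntegralData.{uX, uY, uZ} X Y) (μ : Measure X) (z : D.Z) :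
    eLpNorm (fun x => D.α (x, z)) ∞ μ ≠ ∞ := by
  obtain ⟨-, C, hC⟩ := D.α_mem
  exact ne_top_of_le_ne_top ENNReal.ofReal_ne_top (eLpNorm_top_le_of_bound fun x => hC _)

theorem betaNorm_ne_top (D : IntegralData.{uX, uY, uZ} X Y) (μ : Measure Y) (z : D.Z) :
    eLpNorm (fun y => D.β (y, z)) ∞ μ ≠ ∞ := by
  obtain ⟨-, C, hC⟩ := D.β_mem
  exact ne_top_of_le_ne_top ENNReal.ofReal_ne_top (eLpNorm_top_le_of_bound fun x => hC _)

/-- A function rescaled by `a`, and cut off where it exceeds `a`. -/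
def normalize (c : ℂ) (a : ℝ≥0∞) : ℂ := if ‖c‖ₑ ≤ a then c / (a.toReal : ℂ) else 0

theorem norm_normalize_le (c : ℂ) {a : ℝ≥0∞} (ha : a ≠ ∞) : ‖normalize c a‖ ≤ 1 := by
  unfold normalize
  split_ifs with h
  · rw [norm_div, Complex.norm_real, Real.norm_of_nonneg ENNReal.toReal_nonneg]
    refine div_le_one_of_le₀ ?_ ENNReal.toReal_nonneg
    rw [← toReal_enorm]
    exact ENNReal.toReal_mono ha h
  · simp

theorem measurable_normalize {Ω : Type*} [MeasurableSpace Ω] {f : Ω → ℂ} {a : Ω → ℝ≥0∞}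
    (hf : Measurable f) (ha : Measurable a) : Measurable fun x => normalize (f x) (a x) :=
  Measurable.ite (measurableSet_le hf.enorm ha)
    (hf.div (Complex.measurable_ofReal.comp ha.ennreal_toReal)) measurable_const

/-- If `A * B` vanishes, so does `c * d`. Otherwise `a * b = A * B` together with `a ≤ A` and `b ≤
B` forces `a = A` and `b = B`, so neither cutoff acts and the factors cancel. -/
theorem toReal_mul_normalize_mul {a b A B : ℝ≥0∞} (haA : a ≤ A) (hbB : b ≤ B) (hA : A ≠ ∞)
    (hB : B ≠ ∞) (h : a * b = A * B) {c d : ℂ} (hc : ‖c‖ₑ ≤ A) (hd : ‖d‖ₑ ≤ B) :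
    (a * b).toReal • (normalize c a * normalize d b) = c * d := by
  by_cases h0 : A * B = 0
  · rw [h, h0]
    rcases mul_eq_zero.1 h0 with h1 | h1
    · rw [h1, nonpos_iff_eq_zero, enorm_eq_zero] at hc
      simp [hc]
    · rw [h1, nonpos_iff_eq_zero, enorm_eq_zero] at hd
      simp [hd]
  · have hA0 := left_ne_zero_of_mul h0
    have hB0 := right_ne_zero_of_mul h0
    have ha : a = A := le_antisymm haA <| by
      have h1 : A * B ≤ a * B := h ▸ mul_le_mul_right hbB a
      exact (ENNReal.mul_le_mul_iff_left hB0 hB).1 h1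
    subst ha
    have hb : b = B := (ENNReal.mul_right_inj hA0 hA).1 h
    subst hb
    have h1 : (a.toReal : ℂ) ≠ 0 := by exact_mod_cast ENNReal.toReal_ne_zero.2 ⟨hA0, hA⟩
    have h2 : (b.toReal : ℂ) ≠ 0 := by exact_mod_cast ENNReal.toReal_ne_zero.2 ⟨hB0, hB⟩
    rw [normalize, normalize, if_pos hc, if_pos hd, ENNReal.toReal_mul, Complex.real_smul]
    push_cast
    field_simp

/-- Every decomposition can be replaced by one with functions bounded by `1` and total mass equal
to the cost. -/
theorem exists_normalized (D : IntegralData.{uX, uY, uZ} X Y) {E : PVM X H} {F : PVM Y K}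
    {G : PVM (X × Y) (HilbertSchmidt K H)} (hG : IsDoublePVM E F G) :
    ∃ D' : IntegralData.{uX, uY, uZ} X Y, (∀ p, ‖D'.α p‖ ≤ 1) ∧ (∀ p, ‖D'.β p‖ ≤ 1) ∧
      D'.ν Set.univ = D.cost E F ∧ G.AE fun p => D.value p = D'.value p := by
  -- The norms at a maximising pair serve as normalising factors; their product becomes the density
  -- of the new measure.
  obtain ⟨v, w, hvw⟩ := D.exists_costAt_eq_cost E F
  set a : D.Z → ℝ≥0∞ := fun z => eLpNorm (fun x => D.α (x, z)) ∞ (E.diagMeasure v) with ha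
  set b : D.Z → ℝ≥0∞ := fun z => eLpNorm (fun y => D.β (y, z)) ∞ (F.diagMeasure w) with hb
  have ham : Measurable a := D.measurable_alphaNorm E v
  have hbm : Measurable b := D.measurable_betaNorm F w
  have hat : ∀ z, a z ≠ ∞ := fun z => D.alphaNorm_ne_top _ z
  have hbt : ∀ z, b z ≠ ∞ := fun z => D.betaNorm_ne_top _ z
  have hab : ∫⁻ z, a z * b z ∂D.ν = D.cost E F := hvw
  have hmass : D.ν.withDensity (fun z => a z * b z) Set.univ = D.cost E F := by
    rw [withDensity_apply _ .univ, Measure.restrict_univ, hab]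
  let D' : IntegralData.{uX, uY, uZ} X Y :=
    { Z := D.Z
      ν := D.ν.withDensity fun z => a z * b z
      isFiniteMeasure := ⟨hmass ▸ (D.cost_ne_top E F).lt_top⟩
      α := fun p => normalize (D.α p) (a p.2)
      β := fun p => normalize (D.β p) (b p.2)
      α_mem := ⟨measurable_normalize D.α_mem.1 (ham.comp measurable_snd), 1, fun p =>
        norm_normalize_le _ (hat _)⟩
      β_mem := ⟨measurable_normalize D.β_mem.1 (hbm.comp measurable_snd), 1, fun p =>
        norm_normalize_le _ (hbt _)⟩ }
  refine ⟨D', fun p => norm_normalize_le _ (hat _), fun p => norm_normalize_le _ (hbt _), hmass,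
    (hG.ae_iff (measurableSet_eq_fun D.value_mem.1 D'.value_mem.1)).2 fun v' w' => ?_⟩
  -- Agreement must hold for an arbitrary pair `v', w'`. It is proved for a pair `u, t` dominating
  -- both this pair and the maximising one.
  obtain ⟨u, hu⟩ := E.exists_absolutelyContinuous fun n : ℕ => if n = 0 then v else v'
  obtain ⟨t, ht⟩ := F.exists_absolutelyContinuous fun n : ℕ => if n = 0 then w else w'
  have hvu : E.diagMeasure v ≪ E.diagMeasure u := hu 0
  have hwt : F.diagMeasure w ≪ F.diagMeasure t := ht 0
  have hac : (E.diagMeasure v').prod (F.diagMeasure w') ≪ (E.diagMeasure u).prod (F.diagMeasure t) :=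
    (hu 1).prod (ht 1)
  refine hac.ae_le ?_
  set A : D.Z → ℝ≥0∞ := fun z => eLpNorm (fun x => D.α (x, z)) ∞ (E.diagMeasure u) with hA
  set B : D.Z → ℝ≥0∞ := fun z => eLpNorm (fun y => D.β (y, z)) ∞ (F.diagMeasure t) with hB
  have haA : ∀ z, a z ≤ A z := fun z => by
    simp only [ha, hA, eLpNorm_exponent_top]
    exact eLpNormEssSup_mono_measure _ hvu
  have hbB : ∀ z, b z ≤ B z := fun z => by
    simp only [hb, hB, eLpNorm_exponent_top]
    exact eLpNormEssSup_mono_measure _ hwt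
  have hABm : Measurable fun z => A z * B z :=
    (D.measurable_alphaNorm E u).mul (D.measurable_betaNorm F t)
  -- Maximality: `a b ≤ A B` pointwise, while the integral of `A B` does not exceed the finite
  -- integral of `a b`.
  have hAB : (fun z => a z * b z) =ᵐ[D.ν] fun z => A z * B z := by
    refine ae_eq_of_ae_le_of_lintegral_le (.of_forall fun z => mul_le_mul' (haA z) (hbB z)) ?_
      hABm.aemeasurable ?_
    · rw [hab]; exact D.cost_ne_top E F
    · rw [hab]; exact D.costAt_le_cost E F u t
  filter_upwards [D.ae_ae_enorm_le E F u t] with p hp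
  change ∫ z, D.α (p.1, z) * D.β (p.2, z) ∂D.ν =
    ∫ z, normalize (D.α (p.1, z)) (a z) * normalize (D.β (p.2, z)) (b z)
      ∂D.ν.withDensity fun z => a z * b z
  rw [integral_withDensity_eq_integral_toReal_smul (f := fun z => a z * b z) (ham.mul hbm)
    (.of_forall fun z => (ENNReal.mul_ne_top (hat z) (hbt z)).lt_top)]
  refine integral_congr_ae ?_
  filter_upwards [hp, hAB] with z hz hz'
  exact (toReal_mul_normalize_mul (haA z) (hbB z) (D.alphaNorm_ne_top _ z) (D.betaNorm_ne_top _ z)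
    hz' hz.1 hz.2).symm

end IntegralData

/-! ### The star subalgebras -/

section Subalgebras

variable (X : Type uX) [MeasurableSpace X] (Y : Type uY) [MeasurableSpace Y]

/-- The functions with a strict decomposition form a star subalgebra. -/
def strictSubalgebra : StarSubalgebra ℂ (X × Y → ℂ) where
  carrier := M00.{uX, uY, uZ} X Y
  mul_mem' := by
    rintro f g ⟨D, hD⟩ ⟨D', hD'⟩
    exact ⟨D.mul D', fun p => by rw [D.mul_value, Pi.mul_apply, Pi.mul_apply, hD, hD']⟩
  add_mem' := by
    rintro f g ⟨D, hD⟩ ⟨D', hD'⟩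
    refine ⟨D.add D', fun p => ?_⟩
    rw [D.add_value, Pi.add_apply, Pi.add_apply, hD, hD']
  algebraMap_mem' := fun c => ⟨(IntegralData.one X Y).smul c, fun p => by
    rw [IntegralData.smul_value, IntegralData.one_value, ← Algebra.algebraMap_eq_smul_one]⟩
  star_mem' := by
    rintro f ⟨D, hD⟩
    exact ⟨D.conj, fun p => by rw [D.conj_value, Pi.star_apply, Pi.star_apply, hD]⟩

theorem strictSubalgebra_le : strictSubalgebra.{uX, uY, uZ} X Y ≤ BddMeas (X × Y) := by
  rintro f ⟨D, hD⟩
  rw [show f = D.value from funext hD]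
  exact D.value_mem

end Subalgebras

/-- The canonical projection as a homomorphism of star algebras. -/
def Linfty.projStar {X : Type*} [MeasurableSpace X] {H : Type*} [NormedAddCommGroup H]
    [InnerProductSpace ℂ H] [CompleteSpace H] (E : PVM X H) : BddMeas X →⋆ₐ[ℂ] Linfty E :=
  { Linfty.proj E with map_star' := fun _ => rfl }

theorem Linfty.proj_eq_iff {X : Type*} [MeasurableSpace X] {H : Type*} [NormedAddCommGroup H]
    [InnerProductSpace ℂ H] [CompleteSpace H] (E : PVM X H) (f g : BddMeas X) :
    Linfty.proj E f = Linfty.proj E g ↔ E.AE fun x => (f : X → ℂ) x = (g : X → ℂ) x := by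
  have h : Linfty.proj E f = Linfty.proj E g ↔ f - g ∈ nullIdeal E := Ideal.Quotient.eq
  rw [h]
  constructor <;> intro h'
  · exact PVM.AE.mono (E := E) h' fun x hx => sub_eq_zero.1 hx
  · exact PVM.AE.mono (E := E) h' fun x hx => sub_eq_zero.2 hx

theorem PVM.essNorm_le {X : Type*} [MeasurableSpace X] {H : Type*} [NormedAddCommGroup H]
    [InnerProductSpace ℂ H] [CompleteSpace H] (E : PVM X H) {f : X → ℂ} {c : ℝ} (hc : 0 ≤ c)
    (h : E.AE fun x => ‖f x‖ ≤ c) : E.essNorm f ≤ c :=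
  csInf_le ⟨0, fun _ h => h.1⟩ ⟨hc, h⟩

/-- The function defined by a decomposition, as a bounded measurable function. -/
def IntegralData.val {X : Type uX} [MeasurableSpace X] {Y : Type uY} [MeasurableSpace Y]
    (D : IntegralData.{uX, uY, uZ} X Y) : BddMeas (X × Y) := ⟨D.value, D.value_mem⟩

/-! ### The infimum of costs on `L^∞(G)` -/

section Quotient

variable {X : Type uX} [MeasurableSpace X] {Y : Type uY} [MeasurableSpace Y]
  {H : Type*} [NormedAddCommGroup H] [InnerProductSpace ℂ H] [CompleteSpace H]
  {K : Type*} [NormedAddCommGroup K] [InnerProductSpace ℂ K] [CompleteSpace K]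

/-- `𝔐` as a star subalgebra of `L^∞(G)`. -/
def quotSubalgebra (G : PVM (X × Y) (HilbertSchmidt K H)) : StarSubalgebra ℂ (Linfty G) :=
  ((strictSubalgebra.{uX, uY, uZ} X Y).comap (BddMeas (X × Y)).subtype).map (Linfty.projStar G)

/-- `𝔐₀` as a star subalgebra of the bounded measurable functions. -/
def bddSubalgebra (G : PVM (X × Y) (HilbertSchmidt K H)) : StarSubalgebra ℂ (BddMeas (X × Y)) :=
  (quotSubalgebra.{uX, uY, uZ} G).comap (Linfty.projStar G)

theorem mem_MQuot_iff {G : PVM (X × Y) (HilbertSchmidt K H)} {a : Linfty G} :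
    a ∈ MQuot.{uX, uY, uZ} G ↔ ∃ D : IntegralData.{uX, uY, uZ} X Y, Linfty.proj G D.val = a := by
  constructor
  · rintro ⟨φ, ⟨D, hD⟩, rfl⟩
    exact ⟨D, congrArg _ (Subtype.ext (funext hD).symm)⟩
  · rintro ⟨D, rfl⟩
    exact ⟨D.val, ⟨D, fun _ => rfl⟩, rfl⟩

/-- The infimum of the costs of the decompositions of an element of `L^∞(G)`. -/
def quotNorm (E : PVM X H) (F : PVM Y K) (G : PVM (X × Y) (HilbertSchmidt K H)) (a : Linfty G) :
    ℝ≥0∞ :=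
  ⨅ D : {D : IntegralData.{uX, uY, uZ} X Y // Linfty.proj G D.val = a}, D.1.cost E F

variable {E : PVM X H} {F : PVM Y K} {G : PVM (X × Y) (HilbertSchmidt K H)}

/-- Decomposing `φ` `G`-a.e. depends only on the class of `φ`, so the seminorm descends to the
quotient. -/
theorem quotNorm_proj (φ : BddMeas (X × Y)) :
    quotNorm.{uX, uY, uZ} E F G (Linfty.proj G φ) = M0norm.{uX, uY, uZ} E F G φ := by
  unfold quotNorm M0norm
  rw [iInf_subtype]
  refine iInf_congr fun D => iInf_congr_Prop ?_ fun _ => rfl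
  rw [eq_comm, Linfty.proj_eq_iff]
  rfl

theorem quotNorm_le (D : IntegralData.{uX, uY, uZ} X Y) {a : Linfty G}
    (h : Linfty.proj G D.val = a) : quotNorm.{uX, uY, uZ} E F G a ≤ D.cost E F :=
  iInf_le (fun D : {D : IntegralData.{uX, uY, uZ} X Y // Linfty.proj G D.val = a} => D.1.cost E F)
    ⟨D, h⟩

theorem quotNorm_ne_top {a : Linfty G} (ha : a ∈ MQuot.{uX, uY, uZ} G) :
    quotNorm.{uX, uY, uZ} E F G a ≠ ∞ := by
  obtain ⟨D, hD⟩ := mem_MQuot_iff.1 ha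
  exact ne_top_of_le_ne_top (D.cost_ne_top E F) (quotNorm_le D hD)

/-- Outside `𝔐` the infimum is over an empty family and equals `∞`. The case `c = 0` is separate
because `0 * ∞ = 0`: it needs an explicit decomposition of `0` of cost zero. -/
theorem quotNorm_smul_le (c : ℂ) {a : Linfty G} :
    quotNorm.{uX, uY, uZ} E F G (c • a) ≤ ‖c‖ₑ * quotNorm.{uX, uY, uZ} E F G a := by
  by_cases hc : c = 0
  · subst hc
    rw [enorm_zero, zero_mul]
    have h0 : Linfty.proj G ((IntegralData.one.{uX, uY, uZ} X Y).smul 0).val = 0 := by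
      rw [← map_zero (Linfty.proj G)]
      refine congrArg _ (Subtype.ext ?_)
      exact (IntegralData.smul_value 0 _).trans (zero_smul ℂ _)
    rw [zero_smul]
    refine (quotNorm_le _ h0).trans ((IntegralData.smul_cost_le 0 _ E F).trans_eq ?_)
    rw [enorm_zero, zero_mul]
  · rw [quotNorm, quotNorm, ENNReal.mul_iInf_of_ne (by simpa using hc) enorm_ne_top]
    refine le_iInf fun ⟨D, hD⟩ => ?_
    refine (quotNorm_le (D.smul c) ?_).trans (D.smul_cost_le c E F)
    rw [← hD, ← map_smul]
    exact congrArg _ (Subtype.ext (D.smul_value c))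

theorem quotNorm_add_le (a b : Linfty G) : quotNorm.{uX, uY, uZ} E F G (a + b) ≤
    quotNorm.{uX, uY, uZ} E F G a + quotNorm.{uX, uY, uZ} E F G b := by
  refine ENNReal.le_iInf_add_iInf fun ⟨D, hD⟩ ⟨D', hD'⟩ => ?_
  refine (quotNorm_le (D.add D') ?_).trans (D.add_cost_le D' E F)
  rw [← hD, ← hD', ← map_add]
  exact congrArg _ (Subtype.ext (D.add_value D'))

/-- Membership in `𝔐` makes both factors finite, excluding products `0 * ∞`. -/
theorem quotNorm_mul_le {a b : Linfty G} (ha : a ∈ MQuot.{uX, uY, uZ} G)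
    (hb : b ∈ MQuot.{uX, uY, uZ} G) : quotNorm.{uX, uY, uZ} E F G (a * b) ≤
    quotNorm.{uX, uY, uZ} E F G a * quotNorm.{uX, uY, uZ} E F G b := by
  obtain ⟨D₀, hD₀⟩ := mem_MQuot_iff.1 ha
  obtain ⟨D₁, hD₁⟩ := mem_MQuot_iff.1 hb
  refine ENNReal.le_iInf_mul_iInf ⟨⟨D₀, hD₀⟩, D₀.cost_ne_top E F⟩ ⟨⟨D₁, hD₁⟩, D₁.cost_ne_top E F⟩
    fun ⟨D, hD⟩ ⟨D', hD'⟩ => ?_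
  refine (quotNorm_le (D.mul D') ?_).trans (D.mul_cost_le D' E F)
  rw [← hD, ← hD', ← map_mul]
  exact congrArg _ (Subtype.ext (D.mul_value D'))

theorem quotNorm_star_le (a : Linfty G) :
    quotNorm.{uX, uY, uZ} E F G (star a) ≤ quotNorm.{uX, uY, uZ} E F G a := by
  refine le_iInf fun ⟨D, hD⟩ => ?_
  refine (quotNorm_le D.conj ?_).trans_eq (D.conj_cost E F)
  rw [← hD, Linfty.star_proj]
  exact congrArg _ (Subtype.ext D.conj_value)

theorem quotNorm_star (a : Linfty G) :
    quotNorm.{uX, uY, uZ} E F G (star a) = quotNorm.{uX, uY, uZ} E F G a :=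
  le_antisymm (quotNorm_star_le a) ((congrArg _ (star_star a)).symm.trans_le (quotNorm_star_le _))

theorem quotNorm_zero : quotNorm.{uX, uY, uZ} E F G 0 = 0 := by
  have := quotNorm_smul_le (E := E) (F := F) (0 : ℂ) (a := (0 : Linfty G))
  rwa [zero_smul, enorm_zero, zero_mul, nonpos_iff_eq_zero] at this

theorem quotNorm_one_le : quotNorm.{uX, uY, uZ} E F G 1 ≤ 1 := by
  refine (quotNorm_le (IntegralData.one X Y) ?_).trans (IntegralData.one_cost_le E F)
  rw [← map_one (Linfty.proj G)]
  exact congrArg _ (Subtype.ext IntegralData.one_value)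

theorem ae_norm_le_cost (hG : IsDoublePVM E F G) (D : IntegralData.{uX, uY, uZ} X Y)
    {φ : BddMeas (X × Y)} (h : Linfty.proj G D.val = Linfty.proj G φ) :
    G.AE fun p => ‖(φ : X × Y → ℂ) p‖ ≤ (D.cost E F).toReal :=
  (((Linfty.proj_eq_iff G _ _).1 h).and (D.ae_norm_value_le hG)).mono fun p hp => by
    rw [← hp.1]
    exact hp.2

theorem essNorm_le_quotNorm (hG : IsDoublePVM E F G) (a : Linfty G) :
    ENNReal.ofReal (Linfty.essNorm G a) ≤ quotNorm.{uX, uY, uZ} E F G a := by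
  obtain ⟨φ, rfl⟩ := Linfty.proj_surjective G a
  refine le_iInf fun ⟨D, hD⟩ => ?_
  rw [← ENNReal.ofReal_toReal (D.cost_ne_top E F)]
  exact ENNReal.ofReal_le_ofReal
    (G.essNorm_le ENNReal.toReal_nonneg (ae_norm_le_cost hG D hD))

theorem eq_zero_of_quotNorm (hG : IsDoublePVM E F G) {a : Linfty G}
    (ha : quotNorm.{uX, uY, uZ} E F G a = 0) : a = 0 := by
  obtain ⟨φ, rfl⟩ := Linfty.proj_surjective G a
  rw [← map_zero (Linfty.proj G), Linfty.proj_eq_iff]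
  refine (hG.ae_iff (p := fun p => (φ : X × Y → ℂ) p = 0)
    (measurableSet_eq_fun φ.2.1 measurable_const)).2 fun v w => ?_
  have h : ∀ n : ℕ, ∀ᵐ p ∂(E.diagMeasure v).prod (F.diagMeasure w),
      ‖(φ : X × Y → ℂ) p‖ ≤ 1 / ((n : ℝ) + 1) := fun n => by
    have hn : (0 : ℝ) < 1 / ((n : ℝ) + 1) := Nat.one_div_pos_of_nat
    have h1 : quotNorm.{uX, uY, uZ} E F G (Linfty.proj G φ) < ENNReal.ofReal (1 / ((n : ℝ) + 1)) := by
      rw [ha]; exact ENNReal.ofReal_pos.2 hn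
    obtain ⟨⟨D, hD⟩, hlt⟩ := iInf_lt_iff.1 h1
    have h2 := (ae_norm_le_cost hG D hD).mono fun p hp =>
      hp.trans (ENNReal.toReal_le_of_le_ofReal hn.le hlt.le)
    exact (hG.ae_iff (measurableSet_le φ.2.1.norm measurable_const)).1 h2 v w
  filter_upwards [ae_all_iff.2 h] with p hp
  exact norm_le_zero_iff.1 (ge_of_tendsto' tendsto_one_div_add_atTop_nhds_zero_nat hp)

theorem one_le_essNorm_one [Nontrivial H] [Nontrivial K] : 1 ≤ Linfty.essNorm G 1 := by
  change 1 ≤ G.essNorm 1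
  obtain ⟨v, hv⟩ := exists_ne (0 : H)
  obtain ⟨w, hw⟩ := exists_ne (0 : K)
  refine le_csInf ⟨1, zero_le_one, .of_forall fun x => by simp⟩ ?_
  rintro c ⟨-, N, -, hN0, hN⟩
  by_contra hc
  -- When `c < 1` the bound `1 ≤ c` fails at every point, so the exceptional set is everything and
  -- `G(univ) = 1` would be zero; a nonzero rank-one operator refutes this.
  have hu : N = Set.univ := Set.eq_univ_of_forall fun x => by
    by_contra hx
    exact hc (by simpa using hN x hx)
  rw [hu, G.univ'] at hN0
  have h1 := congrArg (fun T : HilbertSchmidt K H →L[ℂ] HilbertSchmidt K H =>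
    ‖T (HilbertSchmidt.rankOne v w)‖) hN0
  simp only [one_apply_eq_self, zero_apply, norm_zero, HilbertSchmidt.norm_rankOne, mul_eq_zero,
    norm_eq_zero] at h1
  exact h1.elim hv hw

/-- Absolutely convergent series converge in `𝔐`. -/
theorem exists_tendsto_of_summable (hG : IsDoublePVM E F G) {a : ℕ → Linfty G} {ε : ℕ → ℝ≥0∞}
    (hε : ∑' n, ε n ≠ ∞) (ha : ∀ n, quotNorm.{uX, uY, uZ} E F G (a n) < ε n) :
    ∃ b ∈ MQuot.{uX, uY, uZ} G, Filter.Tendsto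
      (fun n => quotNorm.{uX, uY, uZ} E F G (b - ∑ i ∈ Finset.range n, a i)) Filter.atTop
      (nhds 0) := by
  choose D hD using fun n => iInf_lt_iff.1 (ha n)
  -- Normalisation supplies the common bound `1` and the summable masses required for gluing; small
  -- cost alone controls neither.
  choose D' hα hβ hν hD' using fun n => (D n).1.exists_normalized hG
  have hνε : ∀ n, (D' n).ν Set.univ ≤ ε n := fun n => (hν n).trans_le (hD n).le
  have hproj : ∀ n, Linfty.proj G (D' n).val = a n := fun n => by
    rw [← (D n).2]
    exact ((Linfty.proj_eq_iff G _ _).2 (hD' n)).symm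
  have htail : ∀ n, ∑' i, ε (i + n) ≠ ∞ := fun n =>
    ne_top_of_le_ne_top hε (ENNReal.tsum_comp_le_tsum_of_injective (add_left_injective n) ε)
  have hsum : ∀ n, ∑' i, (D' (i + n)).ν Set.univ ≠ ∞ := fun n =>
    ne_top_of_le_ne_top (htail n) (ENNReal.tsum_le_tsum fun i => hνε _)
  -- `T n` glues the tail from index `n`. `T 0` defines the limit, and `T n` decomposes its
  -- difference from the `n`-th partial sum, at a cost bounded by the tail of `∑ ε`.
  let T : ℕ → IntegralData.{uX, uY, uZ} X Y := fun n =>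
    IntegralData.sigma (fun i => D' (i + n)) ⟨1, fun i => hα _⟩ ⟨1, fun i => hβ _⟩ (hsum n)
  have hT : ∀ n p, HasSum (fun i => (D' (i + n)).value p) ((T n).value p) := fun n p =>
    IntegralData.hasSum_sigma_value _ _ _ _ p
  have hcost : ∀ n, (T n).cost E F ≤ ∑' i, ε (i + n) := fun n => by
    refine (IntegralData.sigma_cost_le _ _ _ _ E F).trans (ENNReal.tsum_le_tsum fun i => ?_)
    refine ((D' (i + n)).cost_le_of_bound E F (hα _) (hβ _)).trans ?_
    rw [ENNReal.ofReal_one, one_mul, one_mul]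
    exact hνε _
  refine ⟨Linfty.proj G (T 0).val, mem_MQuot_iff.2 ⟨T 0, rfl⟩, ?_⟩
  refine tendsto_of_tendsto_of_tendsto_of_le_of_le tendsto_const_nhds
    (ENNReal.tendsto_sum_nat_add ε hε) (fun _ => zero_le) fun n => ?_
  refine (quotNorm_le (T n) ?_).trans (hcost n)
  simp only [← hproj, ← map_sum, ← map_sub]
  refine congrArg _ (Subtype.ext (funext fun p => ?_))
  have h1 : (T n).value p = (T 0).value p - ∑ i ∈ Finset.range n, (D' i).value p := by
    rw [← (hT n p).tsum_eq, ← (hT 0 p).tsum_eq, eq_sub_iff_add_eq']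
    exact (hT 0 p).summable.sum_add_tsum_nat_add n
  refine h1.trans ?_
  change _ = (T 0).value p - ((∑ i ∈ Finset.range n, (D' i).val : BddMeas (X × Y)) : X × Y → ℂ) p
  rw [AddSubmonoidClass.coe_finsetSum, Finset.sum_apply]
  rfl

end Quotient

/-! ### The complete algebra norm on `𝔐` -/

section Norm

variable {X : Type uX} [MeasurableSpace X] {Y : Type uY} [MeasurableSpace Y]
  {H : Type*} [NormedAddCommGroup H] [InnerProductSpace ℂ H] [CompleteSpace H]
  {K : Type*} [NormedAddCommGroup K] [InnerProductSpace ℂ K] [CompleteSpace K]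
  {E : PVM X H} {F : PVM Y K} {G : PVM (X × Y) (HilbertSchmidt K H)}

theorem quotNorm_subalgebra_ne_top (a : quotSubalgebra.{uX, uY, uZ} G) :
    quotNorm.{uX, uY, uZ} E F G a ≠ ∞ := quotNorm_ne_top a.2

/-- The norm of `𝔐`. -/
def algebraNorm (hG : IsDoublePVM E F G) : AlgebraNorm ℂ (quotSubalgebra.{uX, uY, uZ} G) :=
  let s : Seminorm ℂ (quotSubalgebra.{uX, uY, uZ} G) :=
    Seminorm.ofSMulLE (fun a => (quotNorm.{uX, uY, uZ} E F G a).toReal)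
      (by rw [ZeroMemClass.coe_zero, quotNorm_zero, ENNReal.toReal_zero])
      (fun a b => by
        rw [← ENNReal.toReal_add (quotNorm_subalgebra_ne_top a) (quotNorm_subalgebra_ne_top b)]
        exact ENNReal.toReal_mono (ENNReal.add_ne_top.2
          ⟨quotNorm_subalgebra_ne_top a, quotNorm_subalgebra_ne_top b⟩) (quotNorm_add_le _ _))
      (fun c a => by
        rw [← toReal_enorm, ← ENNReal.toReal_mul]
        exact ENNReal.toReal_mono (ENNReal.mul_ne_top enorm_ne_top (quotNorm_subalgebra_ne_top a))
          (quotNorm_smul_le c))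
  { s with
    mul_le' := fun a b => by
      change (quotNorm.{uX, uY, uZ} E F G (a * b)).toReal ≤ (quotNorm.{uX, uY, uZ} E F G a).toReal *
        (quotNorm.{uX, uY, uZ} E F G b).toReal
      rw [← ENNReal.toReal_mul]
      exact ENNReal.toReal_mono (ENNReal.mul_ne_top (quotNorm_subalgebra_ne_top a)
        (quotNorm_subalgebra_ne_top b)) (quotNorm_mul_le a.2 b.2)
    eq_zero_of_map_eq_zero' := fun a ha => Subtype.ext <| eq_zero_of_quotNorm hG <|
      ((ENNReal.toReal_eq_zero_iff _).1 ha).resolve_right (quotNorm_subalgebra_ne_top a) }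

theorem algebraNorm_apply (hG : IsDoublePVM E F G) (a : quotSubalgebra.{uX, uY, uZ} G) :
    algebraNorm hG a = (quotNorm.{uX, uY, uZ} E F G a).toReal := rfl

theorem ofReal_algebraNorm (hG : IsDoublePVM E F G) (a : quotSubalgebra.{uX, uY, uZ} G) :
    ENNReal.ofReal (algebraNorm hG a) = quotNorm.{uX, uY, uZ} E F G a :=
  ENNReal.ofReal_toReal (quotNorm_subalgebra_ne_top a)

theorem algebraNorm_one [Nontrivial H] [Nontrivial K] (hG : IsDoublePVM E F G) :
    algebraNorm.{uX, uY, uZ} hG 1 = 1 := by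
  refine le_antisymm (ENNReal.toReal_le_of_le_ofReal zero_le_one ?_) ?_
  · rw [ENNReal.ofReal_one]
    exact quotNorm_one_le
  · rw [← ENNReal.ofReal_le_ofReal_iff (apply_nonneg _ _), ofReal_algebraNorm]
    exact (ENNReal.ofReal_le_ofReal one_le_essNorm_one).trans (essNorm_le_quotNorm hG 1)

theorem algebraNorm_complete (hG : IsDoublePVM E F G) (a : ℕ → quotSubalgebra.{uX, uY, uZ} G)
    (ha : ∀ ε > (0 : ℝ), ∃ n₀, ∀ m ≥ n₀, ∀ n ≥ n₀, algebraNorm hG (a m - a n) < ε) :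
    ∃ b, Filter.Tendsto (fun n => algebraNorm hG (a n - b)) Filter.atTop (nhds 0) := by
  let _ : NormedAddCommGroup (quotSubalgebra.{uX, uY, uZ} G) :=
    (algebraNorm hG).toRingNorm.toAddGroupNorm.toNormedAddCommGroup
  have hnorm : ∀ x : quotSubalgebra.{uX, uY, uZ} G, ‖x‖ = algebraNorm hG x := fun _ => rfl
  have hcauchy : CauchySeq a := Metric.cauchySeq_iff.2 fun ε hε => by
    obtain ⟨n₀, h⟩ := ha ε hε
    exact ⟨n₀, fun m hm n hn => by rw [dist_eq_norm, hnorm]; exact h m hm n hn⟩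
  have : CompleteSpace (quotSubalgebra.{uX, uY, uZ} G) := by
    refine NormedAddCommGroup.completeSpace_of_summable_imp_tendsto fun u hu => ?_
    -- The geometric term gives the strict inequality required to choose decompositions, even where
    -- `‖u n‖ = 0`.
    have hε : ∑' n, (ENNReal.ofReal ‖u n‖ + ENNReal.ofReal ((1 / 2) ^ n)) ≠ ∞ := by
      rw [ENNReal.tsum_add]
      exact ENNReal.add_ne_top.2 ⟨hu.tsum_ofReal_ne_top, summable_geometric_two.tsum_ofReal_ne_top⟩
    obtain ⟨b, hb, hlim⟩ := exists_tendsto_of_summable hG (a := fun n => (u n : Linfty G)) hε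
      fun n => by
        rw [← ofReal_algebraNorm hG, ← hnorm]
        exact ENNReal.lt_add_right ENNReal.ofReal_ne_top
          (ENNReal.ofReal_pos.2 (by positivity)).ne'
    refine ⟨⟨b, hb⟩, tendsto_iff_norm_sub_tendsto_zero.2 ?_⟩
    have h1 := (ENNReal.tendsto_toReal ENNReal.zero_ne_top).comp hlim
    refine h1.congr fun n => ?_
    rw [norm_sub_rev, hnorm, algebraNorm_apply, Function.comp_apply]
    congr 2
    change _ = b - ((∑ i ∈ Finset.range n, u i : quotSubalgebra.{uX, uY, uZ} G) : Linfty G)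
    rw [AddSubmonoidClass.coe_finsetSum]
  obtain ⟨b, hb⟩ := cauchySeq_tendsto_of_complete hcauchy
  exact ⟨b, tendsto_iff_norm_sub_tendsto_zero.1 hb⟩

end Norm

end

/-! ### Assembly of the theorem -/

theorem mainTheorem1
    {X : Type uX} [MeasurableSpace X] {Y : Type uY} [MeasurableSpace Y]
    {H : Type uH} [NormedAddCommGroup H] [InnerProductSpace ℂ H] [CompleteSpace H]
    {K : Type uK} [NormedAddCommGroup K] [InnerProductSpace ℂ K] [CompleteSpace K]
    (E : PVM X H) (F : PVM Y K) :
    -- `𝔐₀₀` is a unital `*`-subalgebra of `B(X × Y)`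
    (∃ A : StarSubalgebra ℂ (X × Y → ℂ),
      (A : Set (X × Y → ℂ)) = M00.{uX, uY, uZ} X Y ∧ A ≤ BddMeas (X × Y)) ∧
    -- the projection-valued measure `G` exists and is unique
    ∃ G : PVM (X × Y) (HilbertSchmidt K H), IsDoublePVM E F G ∧
      (∀ G' : PVM (X × Y) (HilbertSchmidt K H), IsDoublePVM E F G' → G' = G) ∧
      -- `𝔐₀` and `𝔐` are unital `*`-subalgebras of `B(X × Y)` and `L^∞(G)`
      ∃ (A₀ : StarSubalgebra ℂ (BddMeas (X × Y))) (A : StarSubalgebra ℂ (Linfty G)),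
        (A₀ : Set (BddMeas (X × Y))) = M0.{uX, uY, uZ} G ∧
        (A : Set (Linfty G)) = MQuot.{uX, uY, uZ} G ∧
        -- `‖·‖_{𝔐₀}` is finite, a submultiplicative conjugation-invariant seminorm on `𝔐₀`
        ∃ p : Seminorm ℂ A₀,
          (∀ φ : A₀, ENNReal.ofReal (p φ) = M0norm.{uX, uY, uZ} E F G φ) ∧
          (∀ φ ψ : A₀, p (φ * ψ) ≤ p φ * p ψ) ∧
          (∀ φ : A₀, p (star φ) = p φ) ∧
          (∀ φ : A₀, Linfty.essNorm G (Linfty.proj G φ) ≤ p φ) ∧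
          (∀ φ : A₀, p φ = 0 ↔ Linfty.proj G (φ : BddMeas (X × Y)) = 0) ∧
          -- it descends to a norm making `𝔐` a unital Banach `*`-algebra
          ∃ N : AlgebraNorm ℂ A,
            (∀ (φ : A₀) (a : A), Linfty.proj G (φ : BddMeas (X × Y)) = a → N a = p φ) ∧
            (∀ a : A, N (star a) = N a) ∧
            (Nontrivial H → Nontrivial K → N 1 = 1) ∧
            (∀ a : ℕ → A,
              (∀ ε > (0 : ℝ), ∃ n₀, ∀ m ≥ n₀, ∀ n ≥ n₀, N (a m - a n) < ε) →
              ∃ b : A, Filter.Tendsto (fun n => N (a n - b)) Filter.atTop (nhds 0)) := by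
  refine ⟨⟨strictSubalgebra X Y, rfl, strictSubalgebra_le X Y⟩, doublePVM E F,
    isDoublePVM_doublePVM E F, fun _ => (isDoublePVM_doublePVM E F).unique,
    bddSubalgebra _, quotSubalgebra _, rfl, rfl, ?_⟩
  have hG := isDoublePVM_doublePVM E F
  let π : bddSubalgebra.{uX, uY, uZ} (doublePVM E F) →ₗ[ℂ]
      quotSubalgebra.{uX, uY, uZ} (doublePVM E F) :=
    { toFun := fun φ => ⟨Linfty.proj _ φ, φ.2⟩
      map_add' := fun φ ψ => Subtype.ext (map_add (Linfty.proj _) (φ : BddMeas (X × Y)) ψ)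
      map_smul' := fun c φ => Subtype.ext (map_smul (Linfty.proj _) c (φ : BddMeas (X × Y))) }
  have hstar : ∀ a, algebraNorm.{uX, uY, uZ} hG (star a) = algebraNorm hG a := fun a =>
    congrArg ENNReal.toReal (quotNorm_star _)
  -- The seminorm on `𝔐₀` is the pullback of the norm of `𝔐` along `π`, so its properties are those
  -- of the norm.
  let p : Seminorm ℂ (bddSubalgebra.{uX, uY, uZ} (doublePVM E F)) :=
    Seminorm.of (fun φ => algebraNorm hG (π φ))
      (fun φ ψ => (congrArg (algebraNorm hG) (map_add π φ ψ)).trans_le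
        (map_add_le_add (algebraNorm hG) (π φ) (π ψ)))
      (fun c φ => (congrArg (algebraNorm hG) (map_smul π c φ)).trans
        ((algebraNorm hG).smul' c (π φ)))
  refine ⟨p, fun φ => ?_, fun φ ψ => ?_, fun φ => ?_,
    fun φ => ?_, fun φ => ⟨fun h => ?_, fun h => ?_⟩, algebraNorm hG, fun φ a h => ?_, hstar,
    fun _ _ => algebraNorm_one hG, algebraNorm_complete hG⟩
  · exact (ofReal_algebraNorm hG (π φ)).trans (quotNorm_proj _)
  · exact map_mul_le_mul (algebraNorm hG) (π φ) (π ψ)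
  · exact hstar (π φ)
  · refine (ENNReal.ofReal_le_ofReal_iff (apply_nonneg (algebraNorm hG) (π φ))).1 ?_
    exact (essNorm_le_quotNorm hG _).trans_eq (ofReal_algebraNorm hG (π φ)).symm
  · exact congrArg Subtype.val ((algebraNorm hG).eq_zero_of_map_eq_zero' (π φ) h)
  · have : π φ = 0 := Subtype.ext h
    exact (congrArg (algebraNorm hG) this).trans (map_zero (algebraNorm hG))
  · have : a = π φ := Subtype.ext h.symm
    rw [this]
    rfl
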